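/- **Setting.** Let $d\ge 1$, $n\ge 1$, and let $\mathbb{Z}_n^d$ be the discrete torus, regarded as a graph with edge set $E(\mathbb{Z}_n^d)$ (distinct vertices are adjacent when they differ by $\pm1$ in exactly one coordinate). *Dynamical percolation* with parameters $p\in(0,1]$ and $\mu>0$, started from $\eta_0\in\{0,1\}^{E(\mathbb{Z}_n^d)}$, is the càdlàg Markov process $\eta=(\eta_t)_{t\ge0}$ on $\{0,1\}^{E(\mathbb{Z}_n^d)}$ in which the edges evolve independently, each edge switching from $0$ (closed) to $1$ (open) at rate $p\mu$ and from $1$ to $0$ at rate $(1-p)\mu$. Its law is denoted $\mathcal{P}_{\eta_0}$. Given a realisation $\eta$, the random walk $(X_t)_{t\ge0}$ starts at $x$, at rate $1$ chooses a neighbour of its current position in $\mathbb{Z}_n^d$ uniformly at random, and moves there if and only if the connecting edge is open at that time; its (quenched) law is denoted $\mathbb{P}_{x,\eta}$. Let $\pi$ be the uniform distribution on $\mathbb{Z}_n^d$, and for $\varepsilon\in(0,1)$ let $$t_{\mathrm{mix}}(\varepsilon,x,\eta)=\min\{t\ge 0:\ \|\mathbb{P}_{x,\eta}(X_t=\cdot)-\pi\|_{\mathrm{TV}}\le\varepsilon\}\in[0,\infty].$$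 **Theorem.** For all $d\ge1$ and $\delta>0$ there exists $C=C(d,\delta)<\infty$ such that for all $p\in[\delta,1]$, all $n\ge 1$, all $\mu\in(0,1/2]$, all $\varepsilon\in(0,1)$ and all $x\in\mathbb{Z}_n^d$, $$\max_{\eta_0}\ \mathcal{P}_{\eta_0}\!\left(\eta:\ t_{\mathrm{mix}}(\varepsilon,x,\eta)\ \ge\ \frac{C\,n^2\,\max\{\log(1/\varepsilon),\log 2\}}{\mu^4}\right)\le\varepsilon .$$ In particular, for $\varepsilon\le 1/2$ the threshold is $C n^2\log(1/\varepsilon)/\mu^4$. -/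

import Mathlib

open MeasureTheory
open scoped NNReal ENNReal Topology

noncomputable section

namespace DynPerc

/-- The vertex set of the discrete torus `ℤ_n^d`. -/
abbrev Vertex (d n : ℕ) : Type := Fin d → ZMod n

/-- The discrete torus `ℤ_n^d` as a graph: two distinct vertices are adjacent when they differ by
`±1` in exactly one coordinate. -/
def torus (d n : ℕ) : SimpleGraph (Vertex d n) :=
  SimpleGraph.fromRel fun u v => ∃ i : Fin d, v = u + Pi.single i 1

instance (d n : ℕ) : DecidableRel (torus d n).Adj := Classical.decRel _

/-- Edge configurations `{0,1}^{E(ℤ_n^d)}`; `true` is open (state 1), `false` is closed (state 0). -/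
abbrev Config (d n : ℕ) : Type := (torus d n).edgeSet → Bool

/-! ### The environment -/

/-- The jump rates of a single edge: `0 → 1` at rate `p μ` and `1 → 0` at rate `(1 - p) μ`
(a `Q`-matrix: the rows sum to zero). -/
def edgeRate (p μ : ℝ) : Bool → Bool → ℝ
  | false, true => p * μ
  | false, false => -(p * μ)
  | true, false => (1 - p) * μ
  | true, true => -((1 - p) * μ)

/-- The stationary law of a single edge. -/
def edgeStationary (p : ℝ) (b : Bool) : ℝ := if b then p else 1 - p

/-- The transition function of a single edge, i.e. of the two-state Markov chain with rates
`edgeRate p μ`: the probability to be in state `b` at time `t` when started in state `a`.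
It is the solution of the Kolmogorov equation, see `edgeTransition_zero` and
`hasDerivAt_edgeTransition`. -/
def edgeTransition (p μ t : ℝ) (a b : Bool) : ℝ :=
  Real.exp (-(μ * t)) * (if a = b then 1 else 0) + (1 - Real.exp (-(μ * t))) * edgeStationary p b

theorem edgeTransition_zero (p μ : ℝ) (a b : Bool) :
    edgeTransition p μ 0 a b = if a = b then 1 else 0 := by
  simp [edgeTransition]

theorem hasDerivAt_edgeTransition (p μ t : ℝ) (a b : Bool) :
    HasDerivAt (fun s => edgeTransition p μ s a b)
      (∑ c, edgeTransition p μ t a c * edgeRate p μ c b) t := by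
  have h : HasDerivAt (fun s : ℝ => Real.exp (-(μ * s))) (Real.exp (-(μ * t)) * -(μ * 1)) t :=
    (((hasDerivAt_id t).const_mul μ).neg).exp
  have h2 := (h.mul_const (if a = b then (1 : ℝ) else 0)).add
    (((hasDerivAt_const t (1 : ℝ)).sub h).mul_const (edgeStationary p b))
  refine h2.congr_deriv ?_
  rw [Fintype.sum_bool]
  cases a <;> cases b <;> simp [edgeTransition, edgeRate, edgeStationary] <;> ring

/-- The transition function of dynamical percolation: all edges evolve independently. -/
def configTransition {d n : ℕ} [NeZero n] (p μ t : ℝ) (ζ ζ' : Config d n) : ℝ :=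
  ∏ e, edgeTransition p μ t (ζ e) (ζ' e)

/-- Right continuous with left limits. -/
def IsCadlag {d n : ℕ} (η : ℝ≥0 → Config d n) : Prop :=
  ∀ t, ContinuousWithinAt η (Set.Ici t) t ∧ ∃ l, Filter.Tendsto η (𝓝[<] t) (𝓝 l)

/-- The process `η` on the probability space `(Ω, P)` is dynamical percolation on `ℤ_n^d` with
parameters `p` and `μ` started from `η₀`: it is the Markov process with càdlàg paths, initial state
`η₀` and transition function `configTransition p μ`. The law of `η` (a measure on càdlàg paths) is
pinned down by the finite-dimensional distributions given in the last field; the case `k = 0` there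
says that `η 0 = η₀` almost surely. -/
structure IsDynamicalPercolation {d n : ℕ} [NeZero n] (p μ : ℝ) (η₀ : Config d n)
    {Ω : Type*} [MeasurableSpace Ω] (P : Measure Ω) (η : ℝ≥0 → Ω → Config d n) : Prop where
  isProbabilityMeasure : IsProbabilityMeasure P
  measurable : ∀ t, Measurable (η t)
  cadlag : ∀ ω, IsCadlag fun t => η t ω
  finite_dim : ∀ (k : ℕ) (t : ℕ → ℝ≥0) (ζ : ℕ → Config d n), Monotone t → t 0 = 0 → ζ 0 = η₀ →
    P {ω | ∀ i ≤ k, η (t i) ω = ζ i} =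
      ENNReal.ofReal (∏ i ∈ Finset.range k,
        configTransition p μ (t (i + 1) - t i) (ζ i) (ζ (i + 1)))

/-! ### The walk in a fixed environment -/

/-- `x` and `y` are joined by an edge of the torus that is open in the configuration `ζ`. -/
def OpenEdge {d n : ℕ} (ζ : Config d n) (x y : Vertex d n) : Prop :=
  ∃ h : (torus d n).Adj x y, ζ ⟨s(x, y), h⟩ = true

open Classical in
/-- The transition matrix of one attempted jump in the configuration `ζ`: a neighbour in the torus
is chosen uniformly, and the walker moves there if and only if the connecting edge is open. -/
def attempt {d n : ℕ} [NeZero n] (ζ : Config d n) (x y : Vertex d n) : ℝ :=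
  if x = y then 1 - ∑ z, if OpenEdge ζ x z then ((torus d n).degree x : ℝ)⁻¹ else 0
  else if OpenEdge ζ x y then ((torus d n).degree x : ℝ)⁻¹ else 0

/-- The iterated integral
`∫_{0 < s₁ < ⋯ < s_k < t} (K_{η_{s₁}} ⋯ K_{η_{s_k}})(x, y) ds₁ ⋯ ds_k` with `K_ζ = attempt ζ`.
Multiplied by `e^{-t}` it is the probability that a walker started at `x`, with a rate `1` Poisson
clock and in the fixed environment `η`, makes exactly `k` attempts up to time `t` and is at `y`
at time `t`. -/
def attemptsIntegral {d n : ℕ} [NeZero n] (η : ℝ≥0 → Config d n) (x : Vertex d n) :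
    ℕ → ℝ → Vertex d n → ℝ
  | 0, _, y => if x = y then 1 else 0
  | k + 1, t, y => ∫ s in (0 : ℝ)..t,
      ∑ z, attemptsIntegral η x k s z * attempt (η s.toNNReal) z y

/-- The quenched law `ℙ_{x,η}(X_t = y)` of the walk started at `x` in the fixed environment `η`,
with jumps attempted at rate `1`. -/
def quenchedLaw {d n : ℕ} [NeZero n] (η : ℝ≥0 → Config d n) (x : Vertex d n) (t : ℝ≥0)
    (y : Vertex d n) : ℝ :=
  ∑' k : ℕ, Real.exp (-(t : ℝ)) * attemptsIntegral η x k t y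

/-- Total variation distance between `f` and the uniform distribution `π` on `ℤ_n^d`. -/
def tvUniform {d n : ℕ} [NeZero n] (f : Vertex d n → ℝ) : ℝ :=
  (1 / 2) * ∑ y, |f y - 1 / (n : ℝ) ^ d|

/-- The quenched mixing time `t_mix(ε, x, η)`: the first time `t ≥ 0` at which the law of `X_t` is
within `ε` of uniform in total variation; it is `∞` if there is no such time. -/
def quenchedMixingTime {d n : ℕ} [NeZero n] (ε : ℝ) (x : Vertex d n) (η : ℝ≥0 → Config d n) :
    ℝ≥0∞ :=
  ⨅ (t : ℝ≥0) (_ : tvUniform (quenchedLaw η x t) ≤ ε), (t : ℝ≥0∞)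

end DynPerc

end

/-! Given the environment, each attempted jump acts by a symmetric stochastic matrix. The difference
`v` between the law of the walk and the uniform law therefore keeps total mass zero and an `ℓ¹` norm
of at most 2, and its `ℓ²` norm never increases. The proof shows that the expected squared `ℓ²` norm
decays at the diffusive rate, slowed down by a factor `μ`.

The key is a deterministic estimate (`sum_sq_evolve_one_le`): over one unit of time `‖v‖²` drops by
at least `e⁻¹` times the time integral of the Dirichlet form of the environment, evaluated at the
vector from the beginning of the unit interval. That vector depends on the past of the environment
only. Conditionally on this past, an edge is open after a further time `s` with probability at least
`p (1 - e^{-μ s})`, whatever its earlier state. Taking expectations replaces the random Dirichlet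
form by that of the full torus: `E‖v‖²` drops by a constant times `p μ E[gradSq v]`
(`integral_sum_sq_stepEvolve_succ_le`).

Poincaré and Nash-type inequalities on the torus then close the recursion. The Nash inequality is
used separately at each scale `r`, in a form linear in `‖v‖²` and `gradSq v`, with the `ℓ¹` norm
bounded deterministically; so it passes to expectations directly. Dyadic scales bring `E‖v‖²` down
to order `n^{-d}` in time of order `n² / (p μ)`, and Poincaré gives exponential decay afterwards.
Cauchy–Schwarz and Markov's inequality turn this into a bound on the probability that the total
variation distance exceeds `ε`.

The law of the environment is given through finite-dimensional distributions, so the argument is run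
for an environment sampled at multiples of `1 / M`, with bounds uniform in `M`; right continuity of
the paths allows `M → ∞`. The result is a threshold of order `n² / μ`, which is stronger than `n² /
μ⁴`. -/

noncomputable section

/-! ### Symmetric stochastic matrices and their Dirichlet forms -/

namespace DynPerc

/-- A symmetric stochastic matrix on a finite type. -/
structure IsSymmStochastic {V : Type*} [Fintype V] (K : V → V → ℝ) : Prop where
  nonneg : ∀ x y, 0 ≤ K x y
  symm : ∀ x y, K x y = K y x
  sum_right : ∀ x, ∑ y, K x y = 1

/-- The row vector `v` multiplied by the matrix `K`. -/
def act {V : Type*} [Fintype V] (K : V → V → ℝ) (v : V → ℝ) (y : V) : ℝ := ∑ z, v z * K z y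

/-- The Dirichlet form of the matrix `K`. -/
def energy {V : Type*} [Fintype V] (K : V → V → ℝ) (v : V → ℝ) : ℝ :=
  (1 / 2) * ∑ x, ∑ y, K x y * (v x - v y) ^ 2

namespace IsSymmStochastic

variable {V : Type*} [Fintype V] {K : V → V → ℝ}

theorem sum_left (hK : IsSymmStochastic K) (y : V) : ∑ x, K x y = 1 := by
  rw [← hK.sum_right y]
  exact Finset.sum_congr rfl fun x _ => hK.symm x y

theorem le_one (hK : IsSymmStochastic K) (x y : V) : K x y ≤ 1 := by
  rw [← hK.sum_right x]
  exact Finset.single_le_sum (fun z _ => hK.nonneg x z) (Finset.mem_univ y)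

theorem norm_le_one (hK : IsSymmStochastic K) (x y : V) : ‖K x y‖ ≤ 1 := by
  rw [Real.norm_of_nonneg (hK.nonneg x y)]
  exact hK.le_one x y

/-- Self-adjointness, the source of all duality arguments below: bounds on the evolution are proved
by moving the matrices onto a test function. -/
theorem sum_act_mul (hK : IsSymmStochastic K) (v w : V → ℝ) :
    ∑ y, act K v y * w y = ∑ y, v y * act K w y := by
  simp only [act, Finset.sum_mul, Finset.mul_sum]
  rw [Finset.sum_comm]
  refine Finset.sum_congr rfl fun x _ => Finset.sum_congr rfl fun y _ => ?_
  rw [hK.symm x y]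
  ring

theorem act_const (hK : IsSymmStochastic K) (c : ℝ) (y : V) : act K (fun _ => c) y = c := by
  simp [act, ← Finset.mul_sum, hK.sum_left]

theorem norm_act_le (hK : IsSymmStochastic K) (w : V → ℝ) : ‖act K w‖ ≤ ‖w‖ := by
  refine (pi_norm_le_iff_of_nonneg (norm_nonneg _)).2 fun y => ?_
  calc ‖act K w y‖ ≤ ∑ z, ‖w z * K z y‖ := norm_sum_le _ _
    _ ≤ ∑ z, ‖w‖ * K z y := by
        refine Finset.sum_le_sum fun z _ => ?_
        rw [norm_mul, Real.norm_of_nonneg (hK.nonneg z y)]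
        exact mul_le_mul_of_nonneg_right (norm_le_pi_norm w z) (hK.nonneg z y)
    _ = ‖w‖ := by rw [← Finset.mul_sum, hK.sum_left, mul_one]

theorem sum_sq_act_le (hK : IsSymmStochastic K) (v : V → ℝ) :
    ∑ y, act K v y ^ 2 ≤ ∑ y, v y ^ 2 := by
  calc ∑ y, act K v y ^ 2 ≤ ∑ y, ∑ z, K z y * v z ^ 2 := by
        refine Finset.sum_le_sum fun y _ => ?_
        have h := Finset.sum_sq_le_sum_mul_sum_of_sq_le_mul Finset.univ
          (r := fun z => v z * K z y) (f := fun z => K z y) (g := fun z => K z y * v z ^ 2)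
          (fun z _ => hK.nonneg z y) (fun z _ => mul_nonneg (hK.nonneg z y) (sq_nonneg _))
          (fun z _ => le_of_eq (by ring))
        rwa [hK.sum_left, one_mul] at h
    _ = ∑ z, v z ^ 2 := by
        rw [Finset.sum_comm]
        refine Finset.sum_congr rfl fun z _ => ?_
        rw [← Finset.sum_mul, hK.sum_right, one_mul]

theorem energy_eq (hK : IsSymmStochastic K) (v : V → ℝ) :
    energy K v = ∑ y, v y ^ 2 - ∑ y, act K v y * v y := by
  have h1 : ∑ x, ∑ y, K x y * v x ^ 2 = ∑ y, v y ^ 2 :=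
    Finset.sum_congr rfl fun z _ => by rw [← Finset.sum_mul, hK.sum_right, one_mul]
  have h2 : ∑ x, ∑ y, K x y * v y ^ 2 = ∑ y, v y ^ 2 := by
    rw [Finset.sum_comm]
    exact Finset.sum_congr rfl fun z _ => by rw [← Finset.sum_mul, hK.sum_left, one_mul]
  have h3 : ∑ x, ∑ y, K x y * (v x * v y) = ∑ y, act K v y * v y := by
    rw [Finset.sum_comm]
    refine Finset.sum_congr rfl fun y _ => ?_
    rw [act, Finset.sum_mul]
    exact Finset.sum_congr rfl fun x _ => by ring
  have h4 : ∑ x, ∑ y, K x y * (v x - v y) ^ 2 = ∑ x, ∑ y, K x y * v x ^ 2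
      + ∑ x, ∑ y, K x y * v y ^ 2 - 2 * ∑ x, ∑ y, K x y * (v x * v y) := by
    simp only [Finset.mul_sum, ← Finset.sum_add_distrib, ← Finset.sum_sub_distrib]
    exact Finset.sum_congr rfl fun x _ => Finset.sum_congr rfl fun y _ => by ring
  rw [energy, h4, h1, h2, h3]
  ring

/-- One lazy step decreases the `ℓ²` norm by at least half of the Dirichlet form. -/
theorem sum_sq_lazy_le (hK : IsSymmStochastic K) (v : V → ℝ) :
    ∑ y, ((v y + act K v y) / 2) ^ 2 ≤ ∑ y, v y ^ 2 - energy K v / 2 := by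
  have h : ∑ y, ((v y + act K v y) / 2) ^ 2 = (1 / 4) * ∑ y, v y ^ 2
      + (1 / 2) * ∑ y, act K v y * v y + (1 / 4) * ∑ y, act K v y ^ 2 := by
    simp only [Finset.mul_sum, ← Finset.sum_add_distrib]
    exact Finset.sum_congr rfl fun y _ => by ring
  rw [h, hK.energy_eq]
  linarith [hK.sum_sq_act_le v]

end IsSymmStochastic

/-! ### Evolution in a time-dependent environment -/

/-- A measurable time-dependent symmetric stochastic matrix. -/
structure IsSymmEnv {V : Type*} [Fintype V] (K : ℝ → V → V → ℝ) : Prop where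
  stoch : ∀ s, IsSymmStochastic (K s)
  meas : ∀ x y, Measurable fun s => K s x y

/-- The iterated integral of the matrices `K s` over `k` ordered times in `[0, t]`, applied to the
initial vector `v`. -/
def iter {V : Type*} [Fintype V] (K : ℝ → V → V → ℝ) (v : V → ℝ) : ℕ → ℝ → V → ℝ
  | 0, _, y => v y
  | k + 1, t, y => ∫ s in (0 : ℝ)..t, act (K s) (iter K v k s) y

/-- The evolution of the initial vector `v` under the walk whose attempts at time `s` have
transition matrix `K s`. -/
def evolve {V : Type*} [Fintype V] (K : ℝ → V → V → ℝ) (v : V → ℝ) (t : ℝ) (y : V) : ℝ :=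
  ∑' k : ℕ, Real.exp (-t) * iter K v k t y

namespace IsSymmEnv

variable {V : Type*} [Fintype V] {K : ℝ → V → V → ℝ}

theorem shift (hK : IsSymmEnv K) (a : ℝ) : IsSymmEnv fun s => K (a + s) where
  stoch s := hK.stoch (a + s)
  meas x y := (hK.meas x y).comp (measurable_const_add a)

theorem intervalIntegrable_mul (hK : IsSymmEnv K) {f : ℝ → ℝ} (hf : Continuous f) (x y : V)
    (a b : ℝ) : IntervalIntegrable (fun s => f s * K s x y) volume a b := by
  have h := (hf.intervalIntegrable (μ := volume) a b)
  rw [intervalIntegrable_iff] at h ⊢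
  exact h.mul_bdd (c := 1) (hK.meas x y).aestronglyMeasurable
    (Filter.Eventually.of_forall fun s => (hK.stoch s).norm_le_one x y)

theorem intervalIntegrable_act (hK : IsSymmEnv K) {f : ℝ → V → ℝ}
    (hf : ∀ z, Continuous fun s => f s z) (y : V) (a b : ℝ) :
    IntervalIntegrable (fun s => act (K s) (f s) y) volume a b := by
  have h : (fun s => act (K s) (f s) y) = ∑ z, fun s => f s z * K s z y := by
    funext s
    simp [act]
  rw [h]
  exact IntervalIntegrable.sum _ fun z _ => hK.intervalIntegrable_mul (hf z) z y a b

theorem continuous_iter (hK : IsSymmEnv K) (v : V → ℝ) (k : ℕ) :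
    ∀ y, Continuous fun t => iter K v k t y := by
  induction k with
  | zero => intro y; simpa [iter] using continuous_const
  | succ k ih =>
    intro y
    exact intervalIntegral.continuous_primitive (fun a b => hK.intervalIntegrable_act ih y a b) 0

theorem intervalIntegrable_step (hK : IsSymmEnv K) (v : V → ℝ) (k : ℕ) (y : V) (a b : ℝ) :
    IntervalIntegrable (fun s => act (K s) (iter K v k s) y) volume a b :=
  hK.intervalIntegrable_act (hK.continuous_iter v k) y a b

/-- The outermost integration variable is the time of the last attempt; self-adjointness moves that
attempt onto the test function `w`, which makes induction on `k` possible. -/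
theorem sum_iter_succ_mul (hK : IsSymmEnv K) (v w : V → ℝ) (k : ℕ) (t : ℝ) :
    ∑ y, iter K v (k + 1) t y * w y = ∫ s in (0 : ℝ)..t, ∑ y, iter K v k s y * act (K s) w y := by
  simp only [iter]
  calc ∑ y, (∫ s in (0 : ℝ)..t, act (K s) (iter K v k s) y) * w y
      = ∑ y, ∫ s in (0 : ℝ)..t, act (K s) (iter K v k s) y * w y :=
        Finset.sum_congr rfl fun y _ => (intervalIntegral.integral_mul_const _ _).symm
    _ = ∫ s in (0 : ℝ)..t, ∑ y, act (K s) (iter K v k s) y * w y :=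
        (intervalIntegral.integral_finsetSum fun y _ =>
          (hK.intervalIntegrable_step v k y 0 t).mul_const _).symm
    _ = _ := intervalIntegral.integral_congr fun s _ => (hK.stoch s).sum_act_mul _ _

theorem intervalIntegrable_pairing (hK : IsSymmEnv K) (v w : V → ℝ) (k : ℕ) (a b : ℝ) :
    IntervalIntegrable (fun s => ∑ y, iter K v k s y * act (K s) w y) volume a b := by
  have h : (fun s => ∑ y, iter K v k s y * act (K s) w y)
      = ∑ y, fun s => act (K s) (iter K v k s) y * w y := by
    funext s
    rw [← (hK.stoch s).sum_act_mul, Finset.sum_apply]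
  rw [h]
  exact IntervalIntegrable.sum _ fun y _ => (hK.intervalIntegrable_step v k y a b).mul_const _

theorem integral_pow_div_factorial (k : ℕ) (t c : ℝ) :
    ∫ s in (0 : ℝ)..t, s ^ k / (k.factorial : ℝ) * c
      = t ^ (k + 1) / ((k + 1).factorial : ℝ) * c := by
  rw [intervalIntegral.integral_mul_const, intervalIntegral.integral_div, integral_pow,
    Nat.factorial_succ]
  push_cast
  have : (k.factorial : ℝ) ≠ 0 := by positivity
  have : (k : ℝ) + 1 ≠ 0 := by positivity
  field_simp
  simp

/-- A bound for linear functionals of the initial vector that is stable under the dynamics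
propagates to the iterated integrals. -/
theorem sum_iter_mul_le (hK : IsSymmEnv K) (v : V → ℝ) (Φ : (V → ℝ) → ℝ)
    (hΦ : ∀ s w, Φ (act (K s) w) ≤ Φ w) (hv : ∀ w, ∑ y, v y * w y ≤ Φ w) (k : ℕ) :
    ∀ (t : ℝ) (w : V → ℝ), 0 ≤ t →
      ∑ y, iter K v k t y * w y ≤ t ^ k / (k.factorial : ℝ) * Φ w := by
  induction k with
  | zero => intro t w _; simpa [iter] using hv w
  | succ k ih =>
    intro t w ht
    rw [hK.sum_iter_succ_mul, ← integral_pow_div_factorial]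
    refine intervalIntegral.integral_mono_on ht (hK.intervalIntegrable_pairing v w k 0 t)
      (Continuous.intervalIntegrable (by fun_prop) _ _) fun s hs => ?_
    exact (ih s _ hs.1).trans (mul_le_mul_of_nonneg_left (hΦ s w)
      (div_nonneg (pow_nonneg hs.1 k) (Nat.cast_nonneg _)))

theorem sum_iter_mul_le_sum_sq (hK : IsSymmEnv K) (v w : V → ℝ) (k : ℕ) {t : ℝ} (ht : 0 ≤ t) :
    ∑ y, iter K v k t y * w y
      ≤ t ^ k / (k.factorial : ℝ) * ((∑ y, v y ^ 2 + ∑ y, w y ^ 2) / 2) := by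
  refine hK.sum_iter_mul_le v (fun w => (∑ y, v y ^ 2 + ∑ y, w y ^ 2) / 2)
    (fun s w => ?_) (fun w => ?_) k t w ht
  · have := (hK.stoch s).sum_sq_act_le w
    linarith
  · rw [← Finset.sum_add_distrib, Finset.sum_div]
    exact Finset.sum_le_sum fun y _ => by nlinarith [sq_nonneg (v y - w y)]

theorem sum_iter_mul_le_norm (hK : IsSymmEnv K) (v w : V → ℝ) (k : ℕ) {t : ℝ} (ht : 0 ≤ t) :
    ∑ y, iter K v k t y * w y ≤ t ^ k / (k.factorial : ℝ) * ((∑ y, |v y|) * ‖w‖) := by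
  refine hK.sum_iter_mul_le v (fun w => (∑ y, |v y|) * ‖w‖)
    (fun s w => ?_) (fun w => ?_) k t w ht
  · exact mul_le_mul_of_nonneg_left ((hK.stoch s).norm_act_le w)
      (Finset.sum_nonneg fun y _ => abs_nonneg _)
  · rw [Finset.sum_mul]
    refine Finset.sum_le_sum fun y _ => (le_abs_self _).trans ?_
    rw [abs_mul]
    exact mul_le_mul_of_nonneg_left (norm_le_pi_norm w y) (abs_nonneg _)

theorem abs_iter_le (hK : IsSymmEnv K) (v : V → ℝ) (k : ℕ) {t : ℝ} (ht : 0 ≤ t) (y : V) :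
    |iter K v k t y| ≤ t ^ k / (k.factorial : ℝ) * ∑ y, |v y| := by
  classical
  have key : ∀ c : ℝ, |c| = 1 → iter K v k t y * c ≤ t ^ k / (k.factorial : ℝ) * ∑ y, |v y| := by
    intro c hc
    -- The test function `± 1` at `y` extracts a single coordinate from the dual bound.
    have h := hK.sum_iter_mul_le_norm v (Pi.single y c) k ht
    have h1 : ∑ z, iter K v k t z * (Pi.single y c : V → ℝ) z = iter K v k t y * c := by
      rw [Finset.sum_eq_single y]
      · simp
      · intro z _ hz; simp [hz]
      · simp
    have h2 : ‖(Pi.single y c : V → ℝ)‖ ≤ 1 := by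
      refine (pi_norm_le_iff_of_nonneg zero_le_one).2 fun z => ?_
      by_cases hz : z = y
      · subst hz; simp [hc]
      · simp [hz]
    rw [h1] at h
    refine h.trans (mul_le_mul_of_nonneg_left ?_ (by positivity))
    exact mul_le_of_le_one_right (Finset.sum_nonneg fun y _ => abs_nonneg _) h2
  refine abs_le.2 ⟨?_, ?_⟩
  · have := key (-1) (by simp); linarith
  · have := key 1 (by simp); linarith

theorem sum_iter (hK : IsSymmEnv K) (v : V → ℝ) (k : ℕ) :
    ∀ t, ∑ y, iter K v k t y = t ^ k / (k.factorial : ℝ) * ∑ y, v y := by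
  induction k with
  | zero => intro t; simp [iter]
  | succ k ih =>
    intro t
    have h := hK.sum_iter_succ_mul v (fun _ => 1) k t
    simp only [mul_one] at h
    rw [h, ← integral_pow_div_factorial]
    refine intervalIntegral.integral_congr fun s _ => ?_
    simp only [(hK.stoch s).act_const, mul_one]
    exact ih s

theorem iter_const (hK : IsSymmEnv K) (c : ℝ) (k : ℕ) :
    ∀ t y, iter K (fun _ => c) k t y = t ^ k / (k.factorial : ℝ) * c := by
  induction k with
  | zero => intro t y; simp [iter]
  | succ k ih =>
    intro t y
    rw [iter, ← integral_pow_div_factorial]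
    refine intervalIntegral.integral_congr fun s _ => ?_
    have : iter K (fun _ => c) k s = fun _ => s ^ k / (k.factorial : ℝ) * c := funext (ih s)
    simp only [this, (hK.stoch s).act_const]

theorem iter_eq_sum [DecidableEq V] (hK : IsSymmEnv K) (v : V → ℝ) (k : ℕ) :
    ∀ t y, iter K v k t y = ∑ x, v x * iter K (Pi.single x 1) k t y := by
  induction k with
  | zero => intro t y; simp [iter, Pi.single_apply]
  | succ k ih =>
    intro t y
    simp only [iter]
    calc ∫ s in (0 : ℝ)..t, act (K s) (iter K v k s) y
        = ∫ s in (0 : ℝ)..t, ∑ x, v x * act (K s) (iter K (Pi.single x 1) k s) y := by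
          refine intervalIntegral.integral_congr fun s _ => ?_
          simp only [act, ih s, Finset.sum_mul, Finset.mul_sum]
          rw [Finset.sum_comm]
          exact Finset.sum_congr rfl fun x _ => Finset.sum_congr rfl fun y _ => by ring
      _ = ∑ x, ∫ s in (0 : ℝ)..t, v x * act (K s) (iter K (Pi.single x 1) k s) y :=
          intervalIntegral.integral_finsetSum fun x _ =>
            (hK.intervalIntegrable_step _ k y 0 t).const_mul _
      _ = _ := Finset.sum_congr rfl fun x _ => intervalIntegral.integral_const_mul _ _

/-- The `k` ordered times in `[0, a + t]` are split according to how many of them fall before `a`.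
-/
theorem iter_add (hK : IsSymmEnv K) (v : V → ℝ) (a : ℝ) (k : ℕ) : ∀ t y,
    iter K v k (a + t) y = ∑ ij ∈ Finset.HasAntidiagonal.antidiagonal k,
      iter (fun s => K (a + s)) (iter K v ij.1 a) ij.2 t y := by
  induction k with
  | zero => intro t y; simp [iter]
  | succ k ih =>
    intro t y
    rw [Finset.Nat.sum_antidiagonal_succ']
    simp only [iter]
    rw [← intervalIntegral.integral_add_adjacent_intervals (b := a)
      (hK.intervalIntegrable_step v k y _ _) (hK.intervalIntegrable_step v k y _ _)]
    congr 1
    have h := intervalIntegral.integral_comp_add_left (a := 0) (b := t)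
      (fun s => act (K s) (iter K v k s) y) a
    rw [add_zero] at h
    rw [← h, ← intervalIntegral.integral_finsetSum fun ij _ =>
      (hK.shift a).intervalIntegrable_step _ _ y 0 t]
    refine intervalIntegral.integral_congr fun s _ => ?_
    simp only [act, ih s, Finset.sum_mul]
    rw [Finset.sum_comm]

theorem iter_congr {K K' : ℝ → V → V → ℝ} (v : V → ℝ) (k : ℕ) :
    ∀ t, 0 ≤ t → (∀ s ∈ Set.Icc 0 t, K s = K' s) → ∀ y, iter K v k t y = iter K' v k t y := by
  induction k with
  | zero => intro t _ _ y; rfl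
  | succ k ih =>
    intro t ht h y
    simp only [iter]
    refine intervalIntegral.integral_congr fun s hs => ?_
    rw [Set.uIcc_of_le ht] at hs
    have : iter K v k s = iter K' v k s :=
      funext (ih s hs.1 fun r hr => h r ⟨hr.1, hr.2.trans hs.2⟩)
    simp only [h s hs, this]

theorem summable_pow_div_factorial (t c : ℝ) :
    Summable fun k : ℕ => Real.exp (-t) * (t ^ k / (k.factorial : ℝ) * c) :=
  ((Real.summable_pow_div_factorial t).mul_right c).mul_left _

theorem hasSum_exp_series (t c : ℝ) :
    HasSum (fun k : ℕ => Real.exp (-t) * (t ^ k / (k.factorial : ℝ) * c)) c := by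
  have h := ((NormedSpace.expSeries_div_hasSum_exp (𝔸 := ℝ) t).mul_right c).mul_left (Real.exp (-t))
  rwa [← Real.exp_eq_exp_ℝ, ← mul_assoc, ← Real.exp_add, neg_add_cancel, Real.exp_zero,
    one_mul] at h

theorem summable_norm_iter (hK : IsSymmEnv K) (v : V → ℝ) {t : ℝ} (ht : 0 ≤ t) (y : V) :
    Summable fun k : ℕ => ‖Real.exp (-t) * iter K v k t y‖ := by
  refine Summable.of_nonneg_of_le (fun k => norm_nonneg _) (fun k => ?_)
    (summable_pow_div_factorial t (∑ y, |v y|))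
  rw [norm_mul, Real.norm_of_nonneg (Real.exp_pos _).le]
  exact mul_le_mul_of_nonneg_left (hK.abs_iter_le v k ht y) (Real.exp_pos _).le

theorem hasSum_evolve (hK : IsSymmEnv K) (v : V → ℝ) {t : ℝ} (ht : 0 ≤ t) (y : V) :
    HasSum (fun k : ℕ => Real.exp (-t) * iter K v k t y) (evolve K v t y) :=
  (hK.summable_norm_iter v ht y).of_norm.hasSum

theorem hasSum_sum_evolve_mul (hK : IsSymmEnv K) (v w : V → ℝ) {t : ℝ} (ht : 0 ≤ t) :
    HasSum (fun k : ℕ => Real.exp (-t) * ∑ y, iter K v k t y * w y)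
      (∑ y, evolve K v t y * w y) := by
  have h := hasSum_sum (s := Finset.univ) fun y _ => (hK.hasSum_evolve v ht y).mul_right (w y)
  refine (congrArg (HasSum · _) (funext fun k => ?_)).mpr h
  rw [Finset.mul_sum]
  exact Finset.sum_congr rfl fun y _ => by ring

theorem evolve_zero (v : V → ℝ) : evolve K v 0 = v := by
  funext y
  rw [evolve, tsum_eq_single 0]
  · simp [iter]
  · intro k hk
    obtain ⟨j, rfl⟩ := Nat.exists_eq_succ_of_ne_zero hk
    simp [iter]

theorem evolve_congr {K K' : ℝ → V → V → ℝ} {t : ℝ} (v : V → ℝ) (ht : 0 ≤ t)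
    (h : ∀ s ∈ Set.Icc 0 t, K s = K' s) : evolve K v t = evolve K' v t := by
  funext y
  exact tsum_congr fun k => by rw [iter_congr v k t ht h]

theorem evolve_const (hK : IsSymmEnv K) (c : ℝ) {t : ℝ} (y : V) :
    evolve K (fun _ => c) t y = c := by
  simp only [evolve, hK.iter_const]
  exact (hasSum_exp_series t c).tsum_eq

theorem sum_evolve (hK : IsSymmEnv K) (v : V → ℝ) {t : ℝ} (ht : 0 ≤ t) :
    ∑ y, evolve K v t y = ∑ y, v y := by
  have h := hK.hasSum_sum_evolve_mul v (fun _ => 1) ht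
  simp only [mul_one, hK.sum_iter] at h
  exact h.unique (hasSum_exp_series t _)

theorem sum_abs_evolve_le (hK : IsSymmEnv K) (v : V → ℝ) {t : ℝ} (ht : 0 ≤ t) :
    ∑ y, |evolve K v t y| ≤ ∑ y, |v y| := by
  -- The sign of the evolved vector is the test function of sup norm at most 1 that attains the `ℓ¹`
  -- norm.
  set w : V → ℝ := fun y => SignType.sign (evolve K v t y) with hw
  have hw1 : ‖w‖ ≤ 1 := by
    refine (pi_norm_le_iff_of_nonneg zero_le_one).2 fun z => ?_
    rcases lt_trichotomy (evolve K v t z) 0 with h | h | h <;> simp [hw, h]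
  have h := hK.hasSum_sum_evolve_mul v w ht
  have h2 : ∑ y, evolve K v t y * w y = ∑ y, |evolve K v t y| :=
    Finset.sum_congr rfl fun y _ => by rw [hw]; exact self_mul_sign _
  rw [h2] at h
  refine (hasSum_le (fun k => ?_) h (hasSum_exp_series t ((∑ y, |v y|) * ‖w‖))).trans
    (mul_le_of_le_one_right (Finset.sum_nonneg fun y _ => abs_nonneg _) hw1)
  exact mul_le_mul_of_nonneg_left (hK.sum_iter_mul_le_norm v w k ht) (Real.exp_pos _).le

theorem evolve_eq_sum [DecidableEq V] (hK : IsSymmEnv K) (v : V → ℝ) {t : ℝ} (ht : 0 ≤ t) (y : V) :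
    evolve K v t y = ∑ x, v x * evolve K (Pi.single x 1) t y := by
  have h := hasSum_sum (s := Finset.univ) fun x _ =>
    (hK.hasSum_evolve (Pi.single x 1) ht y).mul_left (v x)
  refine (hK.hasSum_evolve v ht y).unique ?_
  refine (congrArg (HasSum · _) (funext fun k => ?_)).mpr h
  rw [hK.iter_eq_sum v, Finset.mul_sum]
  exact Finset.sum_congr rfl fun x _ => by ring

theorem evolve_sub_const (hK : IsSymmEnv K) (v : V → ℝ) (c : ℝ) {t : ℝ} (ht : 0 ≤ t) (y : V) :
    evolve K (fun x => v x - c) t y = evolve K v t y - c := by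
  classical
  conv_rhs => rw [← hK.evolve_const c (t := t) y]
  rw [hK.evolve_eq_sum _ ht, hK.evolve_eq_sum v ht, hK.evolve_eq_sum (fun _ => c) ht,
    ← Finset.sum_sub_distrib]
  exact Finset.sum_congr rfl fun x _ => by ring

/-- The Chapman–Kolmogorov identity: the Cauchy product of the two Poisson series, regrouped by the
total number of attempts, is the sum in `iter_add`. -/
theorem evolve_add (hK : IsSymmEnv K) (v : V → ℝ) {a t : ℝ} (ha : 0 ≤ a) (ht : 0 ≤ t) :
    evolve K v (a + t) = evolve (fun s => K (a + s)) (evolve K v a) t := by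
  classical
  funext y
  rw [(hK.shift a).evolve_eq_sum _ ht]
  have h : ∀ x, evolve K v a x * evolve (fun s => K (a + s)) (Pi.single x 1) t y
      = ∑' k, ∑ ij ∈ Finset.HasAntidiagonal.antidiagonal k, (Real.exp (-a) * iter K v ij.1 a x)
        * (Real.exp (-t) * iter (fun s => K (a + s)) (Pi.single x 1) ij.2 t y) := fun x =>
    tsum_mul_tsum_eq_tsum_sum_antidiagonal_of_summable_norm (hK.summable_norm_iter v ha x)
      ((hK.shift a).summable_norm_iter _ ht y)
  rw [Finset.sum_congr rfl fun x _ => h x, ← Summable.tsum_finsetSum]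
  · refine tsum_congr fun k => ?_
    rw [hK.iter_add, Finset.mul_sum, Finset.sum_comm]
    refine Finset.sum_congr rfl fun ij _ => ?_
    rw [(hK.shift a).iter_eq_sum, Finset.mul_sum]
    refine Finset.sum_congr rfl fun x _ => ?_
    rw [neg_add, Real.exp_add]
    ring
  · intro x _
    exact (summable_norm_sum_mul_antidiagonal_of_summable_norm (hK.summable_norm_iter v ha x)
      ((hK.shift a).summable_norm_iter _ ht y)).of_norm

end IsSymmEnv
end DynPerc

end

/-! ### Dissipation of the squared norm in one unit of time -/

namespace DynPerc
namespace IsSymmEnv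

variable {V : Type*} [Fintype V] {K : ℝ → V → V → ℝ}

theorem measurable_act (hK : IsSymmEnv K) (v : V → ℝ) (y : V) :
    Measurable fun s => act (K s) v y :=
  Finset.measurable_sum _ fun z _ => (hK.meas z y).const_mul (v z)

theorem intervalIntegrable_energy (hK : IsSymmEnv K) (v : V → ℝ) (a b : ℝ) :
    IntervalIntegrable (fun s => energy (K s) v) volume a b := by
  have h : (fun s => energy (K s) v)
      = fun s => (1 / 2) * (∑ x, ∑ y, fun s => (v x - v y) ^ 2 * K s x y) s := by
    funext s
    simp only [energy, Finset.sum_apply]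
    congr 1
    exact Finset.sum_congr rfl fun x _ => Finset.sum_congr rfl fun y _ => mul_comm _ _
  rw [h]
  exact IntervalIntegrable.const_mul (IntervalIntegrable.sum _ fun x _ =>
    IntervalIntegrable.sum _ fun y _ => hK.intervalIntegrable_mul continuous_const x y a b) _

theorem _root_.sq_intervalIntegral_le_integral_sq {h : ℝ → ℝ}
    (h1 : IntervalIntegrable h volume 0 1)
    (h2 : IntervalIntegrable (fun s => h s ^ 2) volume 0 1) :
    (∫ s in (0 : ℝ)..1, h s) ^ 2 ≤ ∫ s in (0 : ℝ)..1, h s ^ 2 := by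
  set m := ∫ s in (0 : ℝ)..1, h s with hm
  have h0 : 0 ≤ ∫ s in (0 : ℝ)..1, (h s - m) ^ 2 :=
    intervalIntegral.integral_nonneg zero_le_one fun s _ => sq_nonneg _
  have h3 : ∫ s in (0 : ℝ)..1, (h s - m) ^ 2 = (∫ s in (0 : ℝ)..1, h s ^ 2) - m ^ 2 := by
    have : ∀ s, (h s - m) ^ 2 = h s ^ 2 - 2 * m * h s + m ^ 2 := fun s => by ring
    simp only [this]
    rw [intervalIntegral.integral_add (h2.sub (h1.const_mul _)) (by simp),
      intervalIntegral.integral_sub h2 (h1.const_mul _), intervalIntegral.integral_const_mul,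
      ← hm]
    simp
    ring
  linarith

/-- The left side is the squared norm of a time average of lazy steps, so Jensen's inequality
reduces it to `sum_sq_lazy_le` at each time. -/
theorem sum_sq_half_step_le (hK : IsSymmEnv K) (v : V → ℝ) :
    ∑ y, ((v y + iter K v 1 1 y) / 2) ^ 2
      ≤ ∑ y, v y ^ 2 - (∫ s in (0 : ℝ)..1, energy (K s) v) / 2 := by
  have hact : ∀ y, IntervalIntegrable (fun s => act (K s) v y) volume 0 1 := fun y =>
    hK.intervalIntegrable_act (f := fun _ => v) (fun _ => continuous_const) y 0 1
  have h1 : ∀ y, IntervalIntegrable (fun s => (v y + act (K s) v y) / 2) volume 0 1 := fun y =>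
    (IntervalIntegrable.add (by simp) (hact y)).div_const 2
  have h2 : ∀ y, IntervalIntegrable (fun s => ((v y + act (K s) v y) / 2) ^ 2) volume 0 1 := by
    intro y
    have h := h1 y
    rw [intervalIntegrable_iff] at h ⊢
    simp only [pow_two]
    refine h.mul_bdd (c := ‖v‖) ((hK.measurable_act v y).const_add _ |>.div_const
      2).aestronglyMeasurable (Filter.Eventually.of_forall fun s => ?_)
    have h3 := norm_le_pi_norm v y
    have h4 := (norm_le_pi_norm (act (K s) v) y).trans ((hK.stoch s).norm_act_le v)
    rw [norm_div, Real.norm_of_nonneg zero_le_two]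
    linarith [norm_add_le (v y) (act (K s) v y)]
  have h3 : ∀ y, (v y + iter K v 1 1 y) / 2 = ∫ s in (0 : ℝ)..1, (v y + act (K s) v y) / 2 := by
    intro y
    rw [intervalIntegral.integral_div, intervalIntegral.integral_add (by simp) (hact y)]
    simp only [iter]
    simp
  calc ∑ y, ((v y + iter K v 1 1 y) / 2) ^ 2
      ≤ ∑ y, ∫ s in (0 : ℝ)..1, ((v y + act (K s) v y) / 2) ^ 2 := by
        refine Finset.sum_le_sum fun y _ => ?_
        rw [h3]
        exact sq_intervalIntegral_le_integral_sq (h1 y) (h2 y)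
    _ = ∫ s in (0 : ℝ)..1, ∑ y, ((v y + act (K s) v y) / 2) ^ 2 :=
        (intervalIntegral.integral_finsetSum fun y _ => h2 y).symm
    _ ≤ ∫ s in (0 : ℝ)..1, (∑ y, v y ^ 2 - energy (K s) v / 2) := by
        refine intervalIntegral.integral_mono_on zero_le_one ?_ ?_
          fun s _ => (hK.stoch s).sum_sq_lazy_le v
        · have h : (fun s => ∑ y, ((v y + act (K s) v y) / 2) ^ 2)
              = ∑ y, fun s => ((v y + act (K s) v y) / 2) ^ 2 := by
            funext s
            rw [Finset.sum_apply]
          rw [h]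
          exact IntervalIntegrable.sum _ fun y _ => h2 y
        · exact IntervalIntegrable.sub (by simp) ((hK.intervalIntegrable_energy v 0 1).div_const 2)
    _ = _ := by
        rw [intervalIntegral.integral_sub (by simp)
          ((hK.intervalIntegrable_energy v 0 1).div_const 2), intervalIntegral.integral_div]
        simp

/-- During one unit of time the squared `ℓ²` norm decreases by a fixed fraction of the Dirichlet
form of the initial vector, integrated over the environment. -/
theorem sum_sq_evolve_one_le (hK : IsSymmEnv K) (v : V → ℝ) :
    ∑ y, evolve K v 1 y ^ 2
      ≤ ∑ y, v y ^ 2 - Real.exp (-1) * ∫ s in (0 : ℝ)..1, energy (K s) v := by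
  set w := evolve K v 1 with hw
  set c := (∑ y, v y ^ 2 + ∑ y, w y ^ 2) / 2 with hc
  set b := ∑ y, ((v y + iter K v 1 1 y) / 2) ^ 2 with hb
  -- `‖w‖²` is the Poisson series of the pairings of `iter K v k 1` with `w`. The terms `k ≥ 2` are
  -- bounded trivially; all the gain comes from `k = 0` and `k = 1`, which have equal weight `e⁻¹`
  -- and together form a lazy step.
  have h1 := (hasSum_nat_add_iff' 2).2 (hK.hasSum_sum_evolve_mul v w zero_le_one)
  have h2 := (hasSum_nat_add_iff' 2).2 (hasSum_exp_series 1 c)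
  have h3 := hasSum_le (fun k => mul_le_mul_of_nonneg_left
    (hK.sum_iter_mul_le_sum_sq v w (k + 2) zero_le_one) (Real.exp_pos (-1)).le) h1 h2
  simp only [Finset.sum_range_succ, Finset.sum_range_zero] at h3
  -- This is `2ab ≤ a² + b²` with `a` the lazy step and `b = w`. In the final summation the
  -- coefficient of `‖w‖²` left over is exactly `1 / 2`.
  have h4 : ∑ y, iter K v 0 1 y * w y + ∑ y, iter K v 1 1 y * w y ≤ b + ∑ y, w y ^ 2 := by
    rw [hb, ← Finset.sum_add_distrib, ← Finset.sum_add_distrib]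
    refine Finset.sum_le_sum fun y _ => ?_
    have : iter K v 0 1 y = v y := rfl
    rw [this]
    nlinarith [sq_nonneg ((v y + iter K v 1 1 y) / 2 - w y)]
  have h6 := hK.sum_sq_half_step_le v
  rw [← hb] at h6
  simp only [Nat.factorial] at h3
  norm_num at h3
  have h5 : ∑ y, evolve K v 1 y * w y = ∑ y, w y ^ 2 :=
    Finset.sum_congr rfl fun y _ => by rw [← hw]; ring
  rw [h5, hc] at h3
  have he := Real.exp_pos (-1)
  have h7 := mul_le_mul_of_nonneg_left h4 he.le
  have h8 := mul_le_mul_of_nonneg_left h6 he.le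
  linarith

/-! ### Stability under pointwise convergence of the environment -/

theorem tendsto_iter {L : ℕ → ℝ → V → V → ℝ} (hL : ∀ N, IsSymmEnv (L N)) (v : V → ℝ)
    (h : ∀ s x y, Filter.Tendsto (fun N => L N s x y) Filter.atTop (𝓝 (K s x y))) (k : ℕ) :
    ∀ (t : ℝ) (_ : 0 ≤ t) (y : V),
      Filter.Tendsto (fun N => iter (L N) v k t y) Filter.atTop (𝓝 (iter K v k t y)) := by
  induction k with
  | zero => intro t _ y; exact tendsto_const_nhds
  | succ k ih =>
    intro t ht y
    simp only [iter]
    refine intervalIntegral.tendsto_integral_filter_of_dominated_convergence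
      (fun s => s ^ k / (k.factorial : ℝ) * ∑ y, |v y|)
      (Filter.Eventually.of_forall fun N =>
        (intervalIntegrable_iff.1 ((hL N).intervalIntegrable_step v k y 0 t)).aestronglyMeasurable)
      (Filter.Eventually.of_forall fun N => Filter.Eventually.of_forall fun s hs => ?_)
      (Continuous.intervalIntegrable (by fun_prop) _ _)
      (Filter.Eventually.of_forall fun s hs => ?_)
    · rw [Set.uIoc_of_le ht] at hs
      have hs0 := hs.1.le
      calc ‖act (L N s) (iter (L N) v k s) y‖
          ≤ ‖iter (L N) v k s‖ :=
            (norm_le_pi_norm (act (L N s) (iter (L N) v k s)) y).trans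
              (((hL N).stoch s).norm_act_le _)
        _ ≤ _ := (pi_norm_le_iff_of_nonneg (by positivity)).2 fun z => (hL N).abs_iter_le v k hs0 z
    · rw [Set.uIoc_of_le ht] at hs
      exact tendsto_finsetSum _ fun z _ => (ih s hs.1.le z).mul (h s z y)

theorem tendsto_evolve {L : ℕ → ℝ → V → V → ℝ} (hL : ∀ N, IsSymmEnv (L N)) (v : V → ℝ)
    (h : ∀ s x y, Filter.Tendsto (fun N => L N s x y) Filter.atTop (𝓝 (K s x y))) {t : ℝ}
    (ht : 0 ≤ t) (y : V) :
    Filter.Tendsto (fun N => evolve (L N) v t y) Filter.atTop (𝓝 (evolve K v t y)) := by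
  refine tendsto_tsum_of_dominated_convergence (summable_pow_div_factorial t (∑ y, |v y|))
    (fun k => (tendsto_iter hL v h k t ht y).const_mul _)
    (Filter.Eventually.of_forall fun N k => ?_)
  rw [norm_mul, Real.norm_of_nonneg (Real.exp_pos _).le]
  exact mul_le_mul_of_nonneg_left ((hL N).abs_iter_le v k ht y) (Real.exp_pos _).le

end IsSymmEnv
end DynPerc

/-! ### The attempt matrix on the torus -/

noncomputable section

namespace DynPerc

theorem torus_adj {d n : ℕ} (x y : Vertex d n) :
    (torus d n).Adj x y ↔
      x ≠ y ∧ ((∃ i, y = x + Pi.single i 1) ∨ ∃ i, x = y + Pi.single i 1) := by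
  rw [torus, SimpleGraph.fromRel_adj]

/-- Translations are automorphisms of the torus. -/
def torusTranslate {d n : ℕ} (a : Vertex d n) : torus d n ≃g torus d n where
  toEquiv := Equiv.addRight a
  map_rel_iff' {x y} := by
    simp only [torus_adj, Equiv.coe_addRight, ne_eq, add_left_inj]
    simp only [add_right_comm _ a, add_left_inj]

theorem degree_torus {d n : ℕ} [NeZero n] (x y : Vertex d n) :
    (torus d n).degree x = (torus d n).degree y := by
  have h := (torusTranslate (y - x)).degree_eq x
  have e : torusTranslate (y - x) x = y := by simp [torusTranslate]
  rw [← h, e]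

theorem degree_torus_le {d n : ℕ} [NeZero n] (x : Vertex d n) :
    (torus d n).degree x ≤ 2 * d := by
  classical
  have h : (torus d n).neighborFinset x ⊆
      (Finset.univ.image fun i => x + Pi.single i 1) ∪
        Finset.univ.image fun i => x - Pi.single i 1 := by
    intro y hy
    rw [SimpleGraph.mem_neighborFinset, torus_adj] at hy
    rcases hy.2 with ⟨i, hi⟩ | ⟨i, hi⟩
    · exact Finset.mem_union_left _ (Finset.mem_image.2 ⟨i, Finset.mem_univ i, hi.symm⟩)
    · exact Finset.mem_union_right _
        (Finset.mem_image.2 ⟨i, Finset.mem_univ i, by rw [hi, add_sub_cancel_right]⟩)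
  rw [← SimpleGraph.card_neighborFinset_eq_degree]
  refine (Finset.card_le_card h).trans ((Finset.card_union_le _ _).trans ?_)
  have h1 := Finset.card_image_le (s := Finset.univ) (f := fun i : Fin d => x + Pi.single i 1)
  have h2 := Finset.card_image_le (s := Finset.univ) (f := fun i : Fin d => x - Pi.single i 1)
  simp only [Finset.card_univ, Fintype.card_fin] at h1 h2
  omega

theorem OpenEdge.symm {d n : ℕ} {ζ : Config d n} {x y : Vertex d n} (h : OpenEdge ζ x y) :
    OpenEdge ζ y x := by
  obtain ⟨h1, h2⟩ := h
  refine ⟨h1.symm, ?_⟩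
  rw [← h2]
  congr 2
  exact Sym2.eq_swap

theorem openEdge_comm {d n : ℕ} {ζ : Config d n} {x y : Vertex d n} :
    OpenEdge ζ x y ↔ OpenEdge ζ y x := ⟨OpenEdge.symm, OpenEdge.symm⟩

theorem isSymmStochastic_attempt {d n : ℕ} [NeZero n] (ζ : Config d n) :
    IsSymmStochastic (attempt ζ) := by
  classical
  have hirr : ∀ x, ¬ OpenEdge ζ x x := fun x h => (torus d n).irrefl h.1
  have hle : ∀ x, ∑ z, (if OpenEdge ζ x z then ((torus d n).degree x : ℝ)⁻¹ else 0) ≤ 1 := by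
    intro x
    rw [← Finset.sum_filter, Finset.sum_const, nsmul_eq_mul]
    have hcard : (Finset.univ.filter (OpenEdge ζ x)).card ≤ (torus d n).degree x := by
      rw [← SimpleGraph.card_neighborFinset_eq_degree]
      refine Finset.card_le_card fun y hy => ?_
      rw [Finset.mem_filter] at hy
      rw [SimpleGraph.mem_neighborFinset]
      exact hy.2.1
    calc _ ≤ ((torus d n).degree x : ℝ) * ((torus d n).degree x : ℝ)⁻¹ :=
          mul_le_mul_of_nonneg_right (by exact_mod_cast hcard) (by positivity)
      _ ≤ 1 := mul_inv_le_one
  refine ⟨fun x y => ?_, fun x y => ?_, fun x => ?_⟩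
  · rw [attempt]
    split_ifs with h
    · exact sub_nonneg.2 (hle x)
    · positivity
    · exact le_rfl
  · by_cases h : x = y
    · rw [h]
    · simp only [attempt, if_neg h, if_neg (Ne.symm h), openEdge_comm (x := x), degree_torus x y]
  · have h : ∀ y, attempt ζ x y = (if x = y then
        1 - ∑ z, (if OpenEdge ζ x z then ((torus d n).degree x : ℝ)⁻¹ else 0) else 0)
        + if OpenEdge ζ x y then ((torus d n).degree x : ℝ)⁻¹ else 0 := by
      intro y
      rw [attempt]
      by_cases h : x = y
      · subst h; simp [hirr x]
      · simp [h]
    simp only [h, Finset.sum_add_distrib]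
    simp

/-- The sum of the squared gradients of `g` on the torus. -/
def gradSq {d n : ℕ} [NeZero n] (g : Vertex d n → ℝ) : ℝ :=
  ∑ i : Fin d, ∑ x, (g (x + Pi.single i 1) - g x) ^ 2

theorem gradSq_nonneg {d n : ℕ} [NeZero n] (g : Vertex d n → ℝ) : 0 ≤ gradSq g :=
  Finset.sum_nonneg fun _ _ => Finset.sum_nonneg fun _ _ => sq_nonneg _

open Classical in
theorem energy_attempt {d n : ℕ} [NeZero n] (ζ : Config d n) (g : Vertex d n → ℝ) :
    energy (attempt ζ) g = (1 / 2) * ∑ x, ∑ y,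
      (if OpenEdge ζ x y then (1 : ℝ) else 0) * (((torus d n).degree x : ℝ)⁻¹ * (g x - g y) ^ 2) := by
  rw [energy]
  congr 1
  refine Finset.sum_congr rfl fun x _ => Finset.sum_congr rfl fun y _ => ?_
  rw [attempt]
  split_ifs with h h2 h2 <;> simp [h]

open Classical in
-- The constant combines the degree bound `2 d`, a factor `d` from bounding each direction by the
-- whole sum over neighbours, and the `1 / 2` of the Dirichlet form.
theorem gradSq_le {d n : ℕ} [NeZero n] (hd : 1 ≤ d) (g : Vertex d n → ℝ) :
    gradSq g / (4 * (d : ℝ) ^ 2) ≤ (1 / 2) * ∑ x, ∑ y,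
      (if (torus d n).Adj x y then (1 : ℝ) else 0) *
        (((torus d n).degree x : ℝ)⁻¹ * (g x - g y) ^ 2) := by
  have hd0 : (0 : ℝ) < d := by exact_mod_cast hd
  have key : ∀ (i : Fin d) (x : Vertex d n), (g (x + Pi.single i 1) - g x) ^ 2 / (2 * d) ≤
      ∑ y, (if (torus d n).Adj x y then (1 : ℝ) else 0) *
        (((torus d n).degree x : ℝ)⁻¹ * (g x - g y) ^ 2) := by
    intro i x
    have hnn : ∀ y ∈ Finset.univ, 0 ≤ (if (torus d n).Adj x y then (1 : ℝ) else 0) *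
        (((torus d n).degree x : ℝ)⁻¹ * (g x - g y) ^ 2) := fun y _ => by
      split_ifs <;> positivity
    by_cases h : x = x + Pi.single i 1
    -- The degenerate torus: the step in direction `i` does not move `x`, so the gradient vanishes.
    · rw [← h]
      simpa using Finset.sum_nonneg hnn
    · refine le_trans ?_ (Finset.single_le_sum hnn (Finset.mem_univ (x + Pi.single i 1)))
      have hadj : (torus d n).Adj x (x + Pi.single i 1) := (torus_adj _ _).2 ⟨h, Or.inl ⟨i, rfl⟩⟩
      rw [if_pos hadj, one_mul, div_eq_inv_mul]
      have hpos : 0 < (torus d n).degree x :=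
        (SimpleGraph.degree_pos_iff_exists_adj (torus d n) x).2 ⟨_, hadj⟩
      have hle : ((torus d n).degree x : ℝ) ≤ 2 * d := by exact_mod_cast degree_torus_le x
      have h1 : (2 * (d : ℝ))⁻¹ ≤ ((torus d n).degree x : ℝ)⁻¹ :=
        inv_anti₀ (by exact_mod_cast hpos) hle
      calc _ ≤ ((torus d n).degree x : ℝ)⁻¹ * (g (x + Pi.single i 1) - g x) ^ 2 :=
            mul_le_mul_of_nonneg_right h1 (sq_nonneg _)
        _ = _ := by ring
  have h1 : gradSq g / (2 * d) ≤ ∑ _i : Fin d, ∑ x, ∑ y,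
      (if (torus d n).Adj x y then (1 : ℝ) else 0) *
        (((torus d n).degree x : ℝ)⁻¹ * (g x - g y) ^ 2) := by
    simp only [gradSq, Finset.sum_div]
    exact Finset.sum_le_sum fun i _ => Finset.sum_le_sum fun x _ => key i x
  rw [Finset.sum_const, Finset.card_univ, Fintype.card_fin, nsmul_eq_mul] at h1
  calc gradSq g / (4 * (d : ℝ) ^ 2) = (gradSq g / (2 * d)) / (2 * d) := by ring
    _ ≤ _ := by
      rw [div_le_iff₀ (by positivity)]
      linarith

end DynPerc

end

/-! ### Poincaré and Nash-type inequalities on the torus -/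

noncomputable section

namespace DynPerc

variable {d n : ℕ} [NeZero n]

/-- The `ℓ²` distance between `g` and its translate by `y`. -/
def translateDist (g : Vertex d n → ℝ) (y : Vertex d n) : ℝ :=
  ‖WithLp.toLp 2 fun x => g (x + y) - g x‖

theorem translateDist_sq (g : Vertex d n → ℝ) (y : Vertex d n) :
    translateDist g y ^ 2 = ∑ x, (g (x + y) - g x) ^ 2 := by
  rw [translateDist, EuclideanSpace.real_norm_sq_eq]

theorem translateDist_nonneg (g : Vertex d n → ℝ) (y : Vertex d n) : 0 ≤ translateDist g y :=
  norm_nonneg _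

theorem translateDist_zero (g : Vertex d n → ℝ) : translateDist g 0 = 0 := by
  have h := translateDist_sq g 0
  simpa using h

theorem translateDist_add_le (g : Vertex d n → ℝ) (y z : Vertex d n) :
    translateDist g (y + z) ≤ translateDist g y + translateDist g z := by
  have h1 : translateDist g z = ‖WithLp.toLp 2 fun x => g (x + y + z) - g (x + y)‖ := by
    refine (sq_eq_sq₀ (translateDist_nonneg _ _) (norm_nonneg _)).1 ?_
    rw [EuclideanSpace.real_norm_sq_eq, translateDist_sq]
    exact (Equiv.sum_comp (Equiv.addRight y) fun x => (g (x + z) - g x) ^ 2).symm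
  rw [h1, translateDist, translateDist]
  refine le_trans (le_of_eq ?_) (norm_add_le _ _)
  congr 1
  ext x
  simp [add_assoc]

theorem translateDist_sum_le {ι : Type*} (g : Vertex d n → ℝ) (s : Finset ι)
    (y : ι → Vertex d n) : translateDist g (∑ i ∈ s, y i) ≤ ∑ i ∈ s, translateDist g (y i) :=
  Finset.le_sum_of_subadditive _ (translateDist_zero g).le (translateDist_add_le g) s y

/-- The translation is a composition of at most `r` unit steps in each direction, and
`translateDist` is subadditive; Cauchy–Schwarz over the `d` directions gives the factor `d`. -/
theorem sum_translate_sub_sq_le (g : Vertex d n → ℝ) (a : Fin d → ℕ) (r : ℕ) (ha : ∀ i, a i ≤ r) :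
    ∑ x, (g (x + fun i => (a i : ZMod n)) - g x) ^ 2 ≤ d * (r : ℝ) ^ 2 * gradSq g := by
  set e : Fin d → ℝ := fun i => translateDist g (Pi.single i 1) with he
  have h1 : (fun i => (a i : ZMod n)) = ∑ i, ∑ _j ∈ Finset.range (a i), Pi.single i 1 := by
    funext j
    simp [Finset.sum_apply, Pi.single_apply]
  have h2 : translateDist g (fun i => (a i : ZMod n)) ≤ r * ∑ i, e i := by
    rw [h1, Finset.mul_sum]
    refine (translateDist_sum_le g _ _).trans (Finset.sum_le_sum fun i _ => ?_)
    refine (translateDist_sum_le g _ _).trans ?_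
    rw [Finset.sum_const, Finset.card_range, nsmul_eq_mul]
    exact mul_le_mul_of_nonneg_right (by exact_mod_cast ha i) (translateDist_nonneg _ _)
  rw [← translateDist_sq]
  calc _ ≤ (r * ∑ i, e i) ^ 2 := pow_le_pow_left₀ (translateDist_nonneg _ _) h2 2
    _ = (r : ℝ) ^ 2 * (∑ i, e i) ^ 2 := by ring
    _ ≤ (r : ℝ) ^ 2 * (d * ∑ i, e i ^ 2) := by
        refine mul_le_mul_of_nonneg_left ?_ (by positivity)
        simpa using sq_sum_le_card_mul_sum_sq (s := Finset.univ) (f := e)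
    _ = d * (r : ℝ) ^ 2 * gradSq g := by
        simp only [he, translateDist_sq, gradSq]
        ring

/-- The Poincaré inequality on the torus. -/
theorem sum_sq_le_gradSq (g : Vertex d n → ℝ) (hg : ∑ x, g x = 0) :
    ∑ x, g x ^ 2 ≤ d * (n : ℝ) ^ 2 * gradSq g := by
  have h1 : ∀ y : Vertex d n, ∑ x, (g (x + y) - g x) ^ 2 ≤ d * (n : ℝ) ^ 2 * gradSq g := by
    intro y
    have h := sum_translate_sub_sq_le g (fun i => (y i).val) n fun i => (ZMod.val_lt _).le
    simpa using h
  -- Summing over all translations compares all pairs of vertices; the cross terms vanish because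
  -- `g` has mean zero.
  have h2 : ∑ y : Vertex d n, ∑ x, (g (x + y) - g x) ^ 2
      = 2 * (Fintype.card (Vertex d n) * ∑ x, g x ^ 2) := by
    rw [Finset.sum_comm]
    have h3 : ∀ x : Vertex d n, ∑ y, (g (x + y) - g x) ^ 2
        = ∑ y, g y ^ 2 + Fintype.card (Vertex d n) * g x ^ 2 := by
      intro x
      have h4 : ∑ y, (g (x + y) - g x) ^ 2 = ∑ y, (g y - g x) ^ 2 :=
        Equiv.sum_comp (Equiv.addLeft x) fun y => (g y - g x) ^ 2
      have h5 : ∀ y, (g y - g x) ^ 2 = g y ^ 2 - 2 * g x * g y + g x ^ 2 := fun y => by ring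
      rw [h4]
      simp only [h5, Finset.sum_add_distrib, Finset.sum_sub_distrib, ← Finset.mul_sum, hg]
      simp
    simp only [h3, Finset.sum_add_distrib, ← Finset.mul_sum]
    rw [Finset.sum_const, Finset.card_univ, nsmul_eq_mul]
    ring
  have h3 := Finset.sum_le_sum fun y (_ : y ∈ Finset.univ) => h1 y
  rw [h2, Finset.sum_const, Finset.card_univ, nsmul_eq_mul] at h3
  have hcard : (0 : ℝ) < Fintype.card (Vertex d n) := by exact_mod_cast Fintype.card_pos
  have h4 : 0 ≤ ∑ x, g x ^ 2 := Finset.sum_nonneg fun x _ => sq_nonneg _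
  have h5 := le_of_mul_le_mul_left ((mul_left_comm _ _ _).trans_le h3) hcard
  linarith

/-- The average of `g` over a cube of side `r`. -/
def cubeAvg (r : ℕ) (g : Vertex d n → ℝ) (x : Vertex d n) : ℝ :=
  ((r : ℝ) ^ d)⁻¹ * ∑ a : Fin d → Fin r, g (x + fun i => ((a i : ℕ) : ZMod n))

theorem card_cube (r : ℕ) : (Fintype.card (Fin d → Fin r) : ℝ) = (r : ℝ) ^ d := by simp

theorem sum_sub_cubeAvg_sq_le {r : ℕ} (hr : 1 ≤ r) (g : Vertex d n → ℝ) :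
    ∑ x, (cubeAvg r g x - g x) ^ 2 ≤ d * (r : ℝ) ^ 2 * gradSq g := by
  have hrd : (0 : ℝ) < (r : ℝ) ^ d := by positivity
  have h1 : ∀ x, (cubeAvg r g x - g x) ^ 2 ≤
      ((r : ℝ) ^ d)⁻¹ * ∑ a : Fin d → Fin r, (g (x + fun i => ((a i : ℕ) : ZMod n)) - g x) ^ 2 := by
    intro x
    have h2 : cubeAvg r g x - g x
        = ((r : ℝ) ^ d)⁻¹ * ∑ a : Fin d → Fin r, (g (x + fun i => ((a i : ℕ) : ZMod n)) - g x) := by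
      rw [Finset.sum_sub_distrib, Finset.sum_const, Finset.card_univ, nsmul_eq_mul, card_cube,
        mul_sub, inv_mul_cancel_left₀ hrd.ne', cubeAvg]
    have h3 := sq_sum_le_card_mul_sum_sq (s := Finset.univ)
      (f := fun a : Fin d → Fin r => g (x + fun i => ((a i : ℕ) : ZMod n)) - g x)
    rw [Finset.card_univ, card_cube] at h3
    rw [h2, mul_pow]
    refine (mul_le_mul_of_nonneg_left h3 (by positivity)).trans (le_of_eq ?_)
    field_simp
  calc _ ≤ ∑ x, ((r : ℝ) ^ d)⁻¹ *
          ∑ a : Fin d → Fin r, (g (x + fun i => ((a i : ℕ) : ZMod n)) - g x) ^ 2 :=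
        Finset.sum_le_sum fun x _ => h1 x
    _ = ((r : ℝ) ^ d)⁻¹ *
          ∑ a : Fin d → Fin r, ∑ x, (g (x + fun i => ((a i : ℕ) : ZMod n)) - g x) ^ 2 := by
        rw [← Finset.mul_sum, Finset.sum_comm]
    _ ≤ ((r : ℝ) ^ d)⁻¹ * ∑ _a : Fin d → Fin r, d * (r : ℝ) ^ 2 * gradSq g := by
        refine mul_le_mul_of_nonneg_left (Finset.sum_le_sum fun a _ => ?_) (by positivity)
        exact sum_translate_sub_sq_le g (fun i => a i) r fun i => (a i).2.le
    _ = _ := by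
        rw [Finset.sum_const, Finset.card_univ, nsmul_eq_mul, card_cube,
          inv_mul_cancel_left₀ hrd.ne']

/-- Interpolation between `ℓ¹` and `ℓ^∞`: averaging does not increase the `ℓ¹` norm and bounds the
sup norm by `r^{-d}` times the `ℓ¹` norm. -/
theorem sum_cubeAvg_sq_le {r : ℕ} (hr : 1 ≤ r) (hrn : r ≤ n) (g : Vertex d n → ℝ) :
    ∑ x, cubeAvg r g x ^ 2 ≤ (∑ x, |g x|) ^ 2 / (r : ℝ) ^ d := by
  have hrd : (0 : ℝ) < (r : ℝ) ^ d := by positivity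
  have habs : ∀ x, |cubeAvg r g x|
      ≤ ((r : ℝ) ^ d)⁻¹ * ∑ a : Fin d → Fin r, |g (x + fun i => ((a i : ℕ) : ZMod n))| := by
    intro x
    rw [cubeAvg, abs_mul, abs_of_pos (inv_pos.2 hrd)]
    exact mul_le_mul_of_nonneg_left (Finset.abs_sum_le_sum_abs _ _) (inv_pos.2 hrd).le
  have hsup : ∀ x, |cubeAvg r g x| ≤ ((r : ℝ) ^ d)⁻¹ * ∑ y, |g y| := by
    intro x
    refine (habs x).trans (mul_le_mul_of_nonneg_left ?_ (inv_pos.2 hrd).le)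
    -- Since `r ≤ n`, the cube does not wrap around the torus, so no vertex is counted twice.
    have hinj : Function.Injective fun a : Fin d → Fin r =>
        x + fun i => ((a i : ℕ) : ZMod n) := by
      intro a b hab
      have h1 := add_left_cancel hab
      funext i
      have h2 := congrFun h1 i
      rw [ZMod.natCast_eq_natCast_iff'] at h2
      rw [Nat.mod_eq_of_lt ((a i).2.trans_le hrn), Nat.mod_eq_of_lt ((b i).2.trans_le hrn)] at h2
      exact Fin.ext h2
    classical
    rw [← Finset.sum_image (f := fun y => |g y|) fun a _ b _ h => hinj h]
    exact Finset.sum_le_univ_sum_of_nonneg fun y => abs_nonneg _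
  have hsum : ∑ x, |cubeAvg r g x| ≤ ∑ y, |g y| := by
    calc _ ≤ ∑ x, ((r : ℝ) ^ d)⁻¹ * ∑ a : Fin d → Fin r, |g (x + fun i => ((a i : ℕ) : ZMod n))| :=
          Finset.sum_le_sum fun x _ => habs x
      _ = ((r : ℝ) ^ d)⁻¹ * ∑ a : Fin d → Fin r, ∑ x, |g (x + fun i => ((a i : ℕ) : ZMod n))| := by
          rw [← Finset.mul_sum, Finset.sum_comm]
      _ = ((r : ℝ) ^ d)⁻¹ * ∑ _a : Fin d → Fin r, ∑ x, |g x| := by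
          congr 1
          exact Finset.sum_congr rfl fun a _ =>
            Equiv.sum_comp (Equiv.addRight fun i => ((a i : ℕ) : ZMod n)) fun x => |g x|
      _ = _ := by
          rw [Finset.sum_const, Finset.card_univ, nsmul_eq_mul, card_cube,
            inv_mul_cancel_left₀ hrd.ne']
  calc _ ≤ ∑ x, (((r : ℝ) ^ d)⁻¹ * ∑ y, |g y|) * |cubeAvg r g x| := by
        refine Finset.sum_le_sum fun x _ => ?_
        rw [← sq_abs, pow_two]
        exact mul_le_mul_of_nonneg_right (hsup x) (abs_nonneg _)
    _ ≤ (((r : ℝ) ^ d)⁻¹ * ∑ y, |g y|) * ∑ y, |g y| := by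
        rw [← Finset.mul_sum]
        refine mul_le_mul_of_nonneg_left hsum (mul_nonneg (inv_pos.2 hrd).le
          (Finset.sum_nonneg fun y _ => abs_nonneg _))
    _ = _ := by ring

/-- A Nash-type inequality on the torus: at each scale `r ≤ n` the `ℓ²` norm is controlled by the
gradient and the `ℓ¹` norm. -/
theorem sum_sq_le_gradSq_add {r : ℕ} (hr : 1 ≤ r) (hrn : r ≤ n) (g : Vertex d n → ℝ) :
    ∑ x, g x ^ 2
      ≤ 2 * (d * (r : ℝ) ^ 2 * gradSq g) + 2 * ((∑ x, |g x|) ^ 2 / (r : ℝ) ^ d) := by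
  have h : ∑ x, g x ^ 2 ≤ 2 * ∑ x, (cubeAvg r g x - g x) ^ 2 + 2 * ∑ x, cubeAvg r g x ^ 2 := by
    rw [Finset.mul_sum, Finset.mul_sum, ← Finset.sum_add_distrib]
    exact Finset.sum_le_sum fun x _ => by nlinarith [sq_nonneg (2 * cubeAvg r g x - g x)]
  linarith [sum_sub_cubeAvg_sq_le hr g, sum_cubeAvg_sq_le hr hrn g]

end DynPerc

end

/-! ### Functions of finitely many observations -/

noncomputable section

/-- The first `k + 1` terms of a sequence. -/
def seqRestrict {S : Type*} (k : ℕ) (y : ℕ → S) (i : Fin (k + 1)) : S := y i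

/-- The extension of a finite sequence by its last term. -/
def seqExtend {S : Type*} (k : ℕ) (τ : Fin (k + 1) → S) (i : ℕ) : S :=
  τ ⟨min i k, by omega⟩

theorem DependsOn.apply_seqExtend_seqRestrict {S β : Type*} {k : ℕ} {F : (ℕ → S) → β}
    (hF : DependsOn F (Set.Iic k)) (y : ℕ → S) : F (seqExtend k (seqRestrict k y)) = F y := by
  refine hF fun i hi => ?_
  simp only [seqExtend, seqRestrict]
  rw [min_eq_left hi]

section FiniteSequences

variable {Ω S : Type*} [MeasurableSpace Ω] [MeasurableSpace S] {Y : Ω → ℕ → S}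

theorem measurable_seqRestrict (hY : ∀ i, Measurable fun ω => Y ω i) (k : ℕ) :
    Measurable fun ω => seqRestrict k (Y ω) :=
  measurable_pi_lambda _ fun i => hY i

variable [Finite S] [MeasurableSingletonClass S] {P : Measure Ω} [IsFiniteMeasure P] {k : ℕ}
  {F : (ℕ → S) → ℝ}

theorem integrable_of_dependsOn (hY : ∀ i, Measurable fun ω => Y ω i)
    (hF : DependsOn F (Set.Iic k)) : Integrable (fun ω => F (Y ω)) P := by
  have h : Integrable (fun τ => F (seqExtend k τ)) (P.map fun ω => seqRestrict k (Y ω)) :=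
    Integrable.of_finite
  have h2 := h.comp_measurable (measurable_seqRestrict hY k)
  simpa only [Function.comp_def, hF.apply_seqExtend_seqRestrict] using h2

/-- With finitely many states, an expectation of a function of finitely many observations is a
finite sum. Integrability, interchange with time integrals and conditioning on the past thereby
become elementary. -/
theorem integral_eq_sum_of_dependsOn [Fintype (Fin (k + 1) → S)]
    (hY : ∀ i, Measurable fun ω => Y ω i) (hF : DependsOn F (Set.Iic k)) :
    ∫ ω, F (Y ω) ∂P
      = ∑ τ, P.real {ω | seqRestrict k (Y ω) = τ} * F (seqExtend k τ) := by
  have hT := measurable_seqRestrict hY k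
  have h1 : ∫ ω, F (Y ω) ∂P = ∫ τ, F (seqExtend k τ) ∂(P.map fun ω => seqRestrict k (Y ω)) := by
    rw [integral_map hT.aemeasurable]
    · simp only [hF.apply_seqExtend_seqRestrict]
    · exact Integrable.of_finite.aestronglyMeasurable
  rw [h1, integral_fintype Integrable.of_finite]
  refine Finset.sum_congr rfl fun τ _ => ?_
  rw [map_measureReal_apply hT (measurableSet_singleton τ), smul_eq_mul]
  rfl

theorem intervalIntegrable_integral_of_dependsOn (hY : ∀ i, Measurable fun ω => Y ω i)
    {Φ : ℝ → (ℕ → S) → ℝ} (hΦ : ∀ s ∈ Set.Icc (0 : ℝ) 1, DependsOn (Φ s) (Set.Iic k))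
    (hi : ∀ ζ, IntervalIntegrable (fun s => Φ s ζ) volume 0 1) :
    IntervalIntegrable (fun s => ∫ ω, Φ s (Y ω) ∂P) volume 0 1 := by
  have := Fintype.ofFinite (Fin (k + 1) → S)
  have h : IntervalIntegrable (∑ τ, fun s =>
      P.real {ω | seqRestrict k (Y ω) = τ} * Φ s (seqExtend k τ)) volume 0 1 :=
    IntervalIntegrable.sum _ fun τ _ => (hi _).const_mul _
  refine h.congr fun s hs => ?_
  rw [Set.uIoc_of_le zero_le_one] at hs
  rw [Finset.sum_apply, integral_eq_sum_of_dependsOn hY (hΦ s ⟨hs.1.le, hs.2⟩)]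

theorem integral_intervalIntegral_of_dependsOn (hY : ∀ i, Measurable fun ω => Y ω i)
    {Φ : ℝ → (ℕ → S) → ℝ} (hΦ : ∀ s ∈ Set.Icc (0 : ℝ) 1, DependsOn (Φ s) (Set.Iic k))
    (hi : ∀ ζ, IntervalIntegrable (fun s => Φ s ζ) volume 0 1) :
    ∫ ω, (∫ s in (0 : ℝ)..1, Φ s (Y ω)) ∂P = ∫ s in (0 : ℝ)..1, ∫ ω, Φ s (Y ω) ∂P := by
  have := Fintype.ofFinite (Fin (k + 1) → S)
  have h1 : DependsOn (fun ζ => ∫ s in (0 : ℝ)..1, Φ s ζ) (Set.Iic k) := fun a b hab => by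
    refine intervalIntegral.integral_congr fun s hs => ?_
    rw [Set.uIcc_of_le zero_le_one] at hs
    exact hΦ s hs hab
  rw [integral_eq_sum_of_dependsOn hY h1]
  simp only [← intervalIntegral.integral_const_mul]
  rw [← intervalIntegral.integral_finsetSum fun τ _ => (hi _).const_mul _]
  refine intervalIntegral.integral_congr fun s hs => ?_
  rw [Set.uIcc_of_le zero_le_one] at hs
  rw [integral_eq_sum_of_dependsOn hY (hΦ s hs)]

end FiniteSequences

/-! ### Conditional probability that an edge is open -/

namespace DynPerc

theorem sum_edgeTransition (p μ t : ℝ) (a : Bool) : ∑ b, edgeTransition p μ t a b = 1 := by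
  cases a <;> simp [edgeTransition, edgeStationary] <;> ring

theorem edgeTransition_nonneg {p μ t : ℝ} (hp : 0 ≤ p) (hp1 : p ≤ 1) (hμ : 0 ≤ μ) (ht : 0 ≤ t)
    (a b : Bool) : 0 ≤ edgeTransition p μ t a b := by
  have h1 : Real.exp (-(μ * t)) ≤ 1 := Real.exp_le_one_iff.2 (by nlinarith)
  have h2 := Real.exp_pos (-(μ * t))
  have h3 : 0 ≤ edgeStationary p b := by
    rw [edgeStationary]
    split_ifs <;> linarith
  rw [edgeTransition]
  refine add_nonneg (mul_nonneg h2.le ?_) (mul_nonneg (by linarith) h3)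
  split_ifs <;> norm_num

/-- An edge is refreshed by time `t` with probability `1 - e^{-μ t}`, and is then open with
probability `p` regardless of its initial state. -/
theorem le_edgeTransition_true (p μ t : ℝ) (a : Bool) :
    p * (1 - Real.exp (-(μ * t))) ≤ edgeTransition p μ t a true := by
  have h2 := Real.exp_pos (-(μ * t))
  cases a <;> simp [edgeTransition, edgeStationary] <;> linarith

theorem configTransition_nonneg {d n : ℕ} [NeZero n] {p μ t : ℝ} (hp : 0 ≤ p) (hp1 : p ≤ 1)
    (hμ : 0 ≤ μ) (ht : 0 ≤ t) (ζ ζ' : Config d n) : 0 ≤ configTransition p μ t ζ ζ' :=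
  Finset.prod_nonneg fun _ _ => edgeTransition_nonneg hp hp1 hμ ht _ _

theorem sum_configTransition_open {d n : ℕ} [NeZero n] (p μ t : ℝ) (ζ : Config d n)
    (e : (torus d n).edgeSet) :
    ∑ ζ' : Config d n, (if ζ' e = true then configTransition p μ t ζ ζ' else 0)
      = edgeTransition p μ t (ζ e) true := by
  have h1 : ∀ ζ' : Config d n, (if ζ' e = true then configTransition p μ t ζ ζ' else 0)
      = ∏ f, (if f = e → ζ' f = true then edgeTransition p μ t (ζ f) (ζ' f) else 0) := by
    intro ζ'
    split_ifs with h
    · refine Finset.prod_congr rfl fun f _ => ?_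
      rw [if_pos]
      rintro rfl
      exact h
    · exact (Finset.prod_eq_zero (Finset.mem_univ e) (by simp [h])).symm
  have h2 := Finset.prod_univ_sum (fun _ : (torus d n).edgeSet => (Finset.univ : Finset Bool))
    (fun f b => if f = e → b = true then edgeTransition p μ t (ζ f) b else 0)
  rw [Fintype.piFinset_univ] at h2
  simp only [h1]
  rw [← h2, Finset.prod_eq_single e]
  · simp
  · intro f _ hf
    simp only [hf, false_implies, if_true]
    exact sum_edgeTransition p μ t _
  · simp

namespace IsDynamicalPercolation

variable {d n : ℕ} [NeZero n] {p μ : ℝ} {η₀ : Config d n} {Ω : Type*} [MeasurableSpace Ω]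
  {P : Measure Ω} {η : ℝ≥0 → Ω → Config d n}

/-- Conditionally on the first `k + 1` observations of the environment, an edge is open at a later
time with probability at least `p (1 - exp (-μ s))`, `s` being the elapsed time. -/
theorem measureReal_inter_open_ge (h : IsDynamicalPercolation p μ η₀ P η) (hp : 0 ≤ p)
    (hp1 : p ≤ 1) (hμ : 0 ≤ μ) (t : ℕ → ℝ≥0) (ht : Monotone t) (ht0 : t 0 = 0) {k l : ℕ}
    (hkl : k ≤ l) (ζ : ℕ → Config d n) (e : (torus d n).edgeSet) :
    p * (1 - Real.exp (-(μ * (t l - t k)))) * P.real {ω | ∀ i ≤ k, η (t i) ω = ζ i}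
      ≤ P.real ({ω | ∀ i ≤ k, η (t i) ω = ζ i} ∩ {ω | η (t l) ω e = true}) := by
  have := h.isProbabilityMeasure
  by_cases h0 : ζ 0 = η₀
  · set w := ∏ i ∈ Finset.range k,
        configTransition p μ (t (i + 1) - t i) (ζ i) (ζ (i + 1)) with hw
    have hle : ∀ i j, i ≤ j → (0 : ℝ) ≤ t j - t i := fun i j hij =>
      sub_nonneg.2 (NNReal.coe_le_coe.2 (ht hij))
    have hw0 : 0 ≤ w := Finset.prod_nonneg fun i _ =>
      configTransition_nonneg hp hp1 hμ (hle _ _ (Nat.le_succ i)) _ _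
    have h1 : P.real {ω | ∀ i ≤ k, η (t i) ω = ζ i} = w := by
      rw [measureReal_def, h.finite_dim k t ζ ht ht0 h0, ENNReal.toReal_ofReal hw0]
    have h2 : ∀ ζ' : Config d n,
        P.real ({ω | ∀ i ≤ k, η (t i) ω = ζ i} ∩ {ω | η (t l) ω = ζ'})
          = w * configTransition p μ (t l - t k) (ζ k) ζ' := by
      intro ζ'
      -- The observation at time `t l` is placed directly after the first `k + 1`; the times
      -- strictly between `t k` and `t l` are skipped.
      set t' : ℕ → ℝ≥0 := fun i => if i ≤ k then t i else t l with ht'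
      set ζ'' : ℕ → Config d n := fun i => if i ≤ k then ζ i else ζ' with hζ''
      have hmono : Monotone t' := by
        refine monotone_nat_of_le_succ fun i => ?_
        simp only [ht']
        split_ifs with h1 h2 h2
        · exact ht (Nat.le_succ i)
        · exact ht (h1.trans hkl)
        · omega
        · exact le_rfl
      have h3 := h.finite_dim (k + 1) t' ζ'' hmono (by simp [ht', ht0]) (by simp [hζ'', h0])
      have hset : {ω | ∀ i ≤ k + 1, η (t' i) ω = ζ'' i}
          = {ω | ∀ i ≤ k, η (t i) ω = ζ i} ∩ {ω | η (t l) ω = ζ'} := by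
        ext ω
        simp only [Set.mem_ofPred_eq, Set.mem_inter_iff, Nat.le_succ_iff]
        constructor
        · intro hω
          refine ⟨fun i hi => ?_, ?_⟩
          · simpa [ht', hζ'', hi] using hω i (Or.inl hi)
          · simpa [ht', hζ''] using hω (k + 1) (Or.inr rfl)
        · rintro ⟨hω1, hω2⟩ i (hi | rfl)
          · simpa [ht', hζ'', hi] using hω1 i hi
          · simpa [ht', hζ''] using hω2
      have hprod : ∏ i ∈ Finset.range (k + 1),
          configTransition p μ (t' (i + 1) - t' i) (ζ'' i) (ζ'' (i + 1))
          = w * configTransition p μ (t l - t k) (ζ k) ζ' := by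
        rw [Finset.prod_range_succ, hw]
        congr 1
        · refine Finset.prod_congr rfl fun i hi => ?_
          have hi' := Finset.mem_range.1 hi
          simp [ht', hζ'', hi'.le, Nat.succ_le_of_lt hi']
        · simp [ht', hζ'']
      rw [measureReal_def, ← hset, h3, hprod, ENNReal.toReal_ofReal]
      exact mul_nonneg hw0 (configTransition_nonneg hp hp1 hμ (hle _ _ hkl) _ _)
    have h4 : P.real ({ω | ∀ i ≤ k, η (t i) ω = ζ i} ∩ {ω | η (t l) ω e = true})
        = ∑ ζ' : Config d n,
          if ζ' e = true then w * configTransition p μ (t l - t k) (ζ k) ζ' else 0 := by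
      rw [← Finset.sum_filter]
      simp only [← h2]
      rw [← measureReal_biUnion_finset]
      · congr 1
        ext ω
        simp
      · intro a _ b _ hab
        refine Set.disjoint_left.2 fun ω ha hb => hab ?_
        exact ha.2.symm.trans hb.2
      · intro ζ' _
        refine MeasurableSet.inter ?_ (h.measurable _ (measurableSet_singleton ζ'))
        simp only [Set.ofPred_forall]
        exact MeasurableSet.iInter fun i => MeasurableSet.iInter fun _ =>
          h.measurable _ (measurableSet_singleton _)
    have h5 : ∀ ζ' : Config d n,
        (if ζ' e = true then w * configTransition p μ (t l - t k) (ζ k) ζ' else 0)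
        = w * if ζ' e = true then configTransition p μ (t l - t k) (ζ k) ζ' else 0 := by
      intro ζ'
      split_ifs <;> simp
    rw [h4, h1]
    simp only [h5]
    rw [← Finset.mul_sum, sum_configTransition_open, mul_comm]
    exact mul_le_mul_of_nonneg_left (le_edgeTransition_true _ _ _ _) hw0
  -- Here the conditioning event is null, because `η 0 = η₀` almost surely.
  · have h1 : P {ω | ∀ i ≤ k, η (t i) ω = ζ i} = 0 := by
      have h2 := h.finite_dim 0 t (fun _ => η₀) ht ht0 rfl
      have h3 : {ω | ∀ i ≤ 0, η (t i) ω = η₀} = {ω | η 0 ω = η₀} := by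
        ext ω
        simp [ht0]
      rw [h3, Finset.range_zero, Finset.prod_empty, ENNReal.ofReal_one] at h2
      have h4 : MeasurableSet {ω | η 0 ω = η₀} := h.measurable 0 (measurableSet_singleton η₀)
      refine measure_mono_null (fun ω hω => ?_) ((prob_compl_eq_zero_iff h4).2 h2)
      have h5 := hω 0 (Nat.zero_le k)
      rw [ht0] at h5
      intro h6
      exact h0 (h5.symm.trans h6)
    rw [measureReal_def, h1, ENNReal.toReal_zero, mul_zero]
    exact measureReal_nonneg

/-- The integrated form of the Markov property: `F` is constant on each atom of the first `k + 1`
observations, and the conditional bound is summed over these atoms. -/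
theorem integral_le_setIntegral_open (h : IsDynamicalPercolation p μ η₀ P η) (hp : 0 ≤ p)
    (hp1 : p ≤ 1) (hμ : 0 ≤ μ) (t : ℕ → ℝ≥0) (ht : Monotone t) (ht0 : t 0 = 0) {k l : ℕ}
    (hkl : k ≤ l) {F : (ℕ → Config d n) → ℝ} (hF : DependsOn F (Set.Iic k)) (hF0 : ∀ ζ, 0 ≤ F ζ)
    (e : (torus d n).edgeSet) :
    p * (1 - Real.exp (-(μ * (t l - t k)))) * ∫ ω, F (fun i => η (t i) ω) ∂P
      ≤ ∫ ω in {ω | η (t l) ω e = true}, F (fun i => η (t i) ω) ∂P := by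
  have := h.isProbabilityMeasure
  classical
  have hY : ∀ i, Measurable fun ω => η (t i) ω := fun i => h.measurable (t i)
  rw [integral_eq_sum_of_dependsOn (P := P) (Y := fun ω i => η (t i) ω) hY hF,
    integral_eq_sum_of_dependsOn (P := P.restrict _) (Y := fun ω i => η (t i) ω) hY hF,
    Finset.mul_sum]
  refine Finset.sum_le_sum fun τ _ => ?_
  rw [← mul_assoc]
  refine mul_le_mul_of_nonneg_right ?_ (hF0 _)
  have hm : MeasurableSet {ω | seqRestrict k (fun i => η (t i) ω) = τ} :=
    measurable_seqRestrict (Y := fun ω i => η (t i) ω) hY k (measurableSet_singleton τ)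
  rw [measureReal_restrict_apply hm]
  have hset : {ω | seqRestrict k (fun i => η (t i) ω) = τ}
      = {ω | ∀ i ≤ k, η (t i) ω = seqExtend k τ i} := by
    ext ω
    simp only [Set.mem_ofPred_eq, funext_iff (f := seqRestrict k _), seqRestrict, seqExtend]
    constructor
    · intro hω i hi
      have := hω ⟨i, by omega⟩
      simp only [min_eq_left hi]
      exact this
    · intro hω i
      have hi : (i : ℕ) ≤ k := by omega
      have := hω i hi
      simp only [min_eq_left hi] at this
      exact this
  rw [hset]
  exact h.measureReal_inter_open_ge hp hp1 hμ t ht ht0 hkl _ e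

/-- The expected Dirichlet form of the environment at a later time, evaluated at a function that
depends on the past only, dominates the squared gradient. -/
theorem integral_gradSq_le_integral_energy (h : IsDynamicalPercolation p μ η₀ P η) (hp : 0 ≤ p)
    (hp1 : p ≤ 1) (hμ : 0 ≤ μ) (hd : 1 ≤ d) (t : ℕ → ℝ≥0) (ht : Monotone t) (ht0 : t 0 = 0)
    {k l : ℕ} (hkl : k ≤ l) {g : (ℕ → Config d n) → Vertex d n → ℝ}
    (hg : DependsOn g (Set.Iic k)) :
    p * (1 - Real.exp (-(μ * (t l - t k)))) / (4 * (d : ℝ) ^ 2)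
        * ∫ ω, gradSq (g fun i => η (t i) ω) ∂P
      ≤ ∫ ω, energy (attempt (η (t l) ω)) (g fun i => η (t i) ω) ∂P := by
  have := h.isProbabilityMeasure
  classical
  set q := p * (1 - Real.exp (-(μ * (t l - t k)))) with hq
  have hq0 : 0 ≤ q := by
    refine mul_nonneg hp (sub_nonneg.2 (Real.exp_le_one_iff.2 ?_))
    have := mul_nonneg hμ (sub_nonneg.2 (NNReal.coe_le_coe.2 (ht hkl)))
    linarith
  have hY : ∀ i, Measurable fun ω => η (t i) ω := fun i => h.measurable (t i)
  set D : Vertex d n → Vertex d n → (ℕ → Config d n) → ℝ := fun x y ζ =>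
    ((torus d n).degree x : ℝ)⁻¹ * (g ζ x - g ζ y) ^ 2 with hD
  have hDdep : ∀ x y, DependsOn (D x y) (Set.Iic k) := fun x y a b hab => by
    simp only [hD, hg hab]
  have hD0 : ∀ x y ζ, 0 ≤ D x y ζ := fun x y ζ => by positivity
  have hint : ∀ x y, Integrable (fun ω => D x y fun i => η (t i) ω) P := fun x y =>
    integrable_of_dependsOn (Y := fun ω i => η (t i) ω) hY (hDdep x y)
  have hintg : Integrable (fun ω => gradSq (g fun i => η (t i) ω)) P :=
    integrable_of_dependsOn (Y := fun ω i => η (t i) ω) (k := k) (F := fun ζ => gradSq (g ζ)) hY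
      fun a b hab => by simp only [hg hab]
  have hmeas : ∀ x y, MeasurableSet {ω | OpenEdge (η (t l) ω) x y} := fun x y =>
    h.measurable (t l) (Set.toFinite {ζ : Config d n | OpenEdge ζ x y}).measurableSet
  have hind : ∀ x y, (fun ω => (if OpenEdge (η (t l) ω) x y then (1 : ℝ) else 0)
      * D x y fun i => η (t i) ω)
      = {ω | OpenEdge (η (t l) ω) x y}.indicator fun ω => D x y fun i => η (t i) ω := by
    intro x y
    funext ω
    simp [Set.indicator_apply]
  have hterm : ∀ x y, q * ∫ ω, (if (torus d n).Adj x y then (1 : ℝ) else 0)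
      * (D x y fun i => η (t i) ω) ∂P
      ≤ ∫ ω, (if OpenEdge (η (t l) ω) x y then (1 : ℝ) else 0) * (D x y fun i => η (t i) ω) ∂P := by
    intro x y
    by_cases hxy : (torus d n).Adj x y
    · simp only [if_pos hxy, one_mul]
      rw [hind, integral_indicator (hmeas x y)]
      have hset : {ω | OpenEdge (η (t l) ω) x y}
          = {ω | η (t l) ω ⟨s(x, y), hxy⟩ = true} := by
        ext ω
        exact ⟨fun ho => ho.2, fun ho => ⟨hxy, ho⟩⟩
      rw [hset]
      exact h.integral_le_setIntegral_open hp hp1 hμ t ht ht0 hkl (hDdep x y) (hD0 x y) _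
    · simp only [if_neg hxy, zero_mul, integral_zero, mul_zero]
      refine integral_nonneg fun ω => ?_
      exact mul_nonneg (by split_ifs <;> norm_num) (hD0 _ _ _)
  have hI1 : ∀ x y, Integrable (fun ω => (if (torus d n).Adj x y then (1 : ℝ) else 0)
      * (D x y fun i => η (t i) ω)) P := fun x y => (hint x y).const_mul _
  have hI2 : ∀ x y, Integrable (fun ω => (if OpenEdge (η (t l) ω) x y then (1 : ℝ) else 0)
      * (D x y fun i => η (t i) ω)) P := fun x y => by
    rw [hind]
    exact (hint x y).indicator (hmeas x y)
  calc q / (4 * (d : ℝ) ^ 2) * ∫ ω, gradSq (g fun i => η (t i) ω) ∂P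
      = q * ∫ ω, gradSq (g fun i => η (t i) ω) / (4 * (d : ℝ) ^ 2) ∂P := by
        rw [integral_div]
        ring
    _ ≤ q * ∫ ω, (1 / 2) * ∑ x, ∑ y, (if (torus d n).Adj x y then (1 : ℝ) else 0)
          * (D x y fun i => η (t i) ω) ∂P := by
        refine mul_le_mul_of_nonneg_left ?_ hq0
        refine integral_mono (hintg.div_const _) ?_ fun ω => gradSq_le hd _
        exact (integrable_finsetSum _ fun x _ => integrable_finsetSum _ fun y _ =>
          hI1 x y).const_mul _
    _ = (1 / 2) * ∑ x, ∑ y, q * ∫ ω, (if (torus d n).Adj x y then (1 : ℝ) else 0)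
          * (D x y fun i => η (t i) ω) ∂P := by
        rw [integral_const_mul, integral_finsetSum _ fun x _ => integrable_finsetSum _ fun y _ =>
          hI1 x y]
        simp only [integral_finsetSum _ fun y _ => hI1 _ y, ← Finset.mul_sum]
        ring
    _ ≤ (1 / 2) * ∑ x, ∑ y, ∫ ω, (if OpenEdge (η (t l) ω) x y then (1 : ℝ) else 0)
          * (D x y fun i => η (t i) ω) ∂P := by
        refine mul_le_mul_of_nonneg_left ?_ (by norm_num)
        exact Finset.sum_le_sum fun x _ => Finset.sum_le_sum fun y _ => hterm x y
    _ = ∫ ω, energy (attempt (η (t l) ω)) (g fun i => η (t i) ω) ∂P := by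
        simp only [energy_attempt]
        rw [integral_const_mul, integral_finsetSum _ fun x _ => integrable_finsetSum _ fun y _ =>
          hI2 x y]
        simp only [integral_finsetSum _ fun y _ => hI2 _ y]

end IsDynamicalPercolation
end DynPerc

end

/-! ### Expected dissipation in the discretised environment -/

noncomputable section

namespace DynPerc

variable {d n : ℕ} [NeZero n]

/-- The environment that follows the sequence of configurations `ζ`, changing at the multiples of
`1 / M`. -/
def stepEnv (M : ℕ) (ζ : ℕ → Config d n) (s : ℝ) : Vertex d n → Vertex d n → ℝ :=
  attempt (ζ ⌈s * M⌉₊)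

theorem isSymmEnv_stepEnv (M : ℕ) (ζ : ℕ → Config d n) : IsSymmEnv (stepEnv M ζ) where
  stoch _ := isSymmStochastic_attempt _
  meas x y := (measurable_from_nat (f := fun i => attempt (ζ i) x y)).comp
    (Nat.measurable_ceil.comp (measurable_id.mul_const (M : ℝ)))

/-- The vector `v` evolved up to time `m` in the environment `stepEnv M ζ`. -/
def stepEvolve (M : ℕ) (v : Vertex d n → ℝ) (m : ℕ) (ζ : ℕ → Config d n) : Vertex d n → ℝ :=
  evolve (stepEnv M ζ) v m

/-- Adaptedness: up to time `m` only grid indices up to `m * M` are visible. This makes the later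
environment usable at a vector fixed by the past. -/
theorem dependsOn_stepEvolve (M : ℕ) (v : Vertex d n → ℝ) (m : ℕ) :
    DependsOn (stepEvolve M v m) (Set.Iic (m * M)) := by
  intro ζ ζ' h
  refine IsSymmEnv.evolve_congr v (Nat.cast_nonneg m) fun s hs => ?_
  rw [stepEnv, stepEnv, h]
  rw [Set.mem_Iic, Nat.ceil_le]
  push_cast
  exact mul_le_mul_of_nonneg_right hs.2 (Nat.cast_nonneg M)

theorem sum_sq_stepEvolve_succ_le (M : ℕ) (v : Vertex d n → ℝ) (m : ℕ) (ζ : ℕ → Config d n) :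
    ∑ y, stepEvolve M v (m + 1) ζ y ^ 2 ≤ ∑ y, stepEvolve M v m ζ y ^ 2
      - Real.exp (-1) * ∫ s in (0 : ℝ)..1, energy (stepEnv M ζ (m + s)) (stepEvolve M v m ζ) := by
  have h := ((isSymmEnv_stepEnv M ζ).shift m).sum_sq_evolve_one_le (stepEvolve M v m ζ)
  have h2 : stepEvolve M v (m + 1) ζ
      = evolve (fun s => stepEnv M ζ (m + s)) (stepEvolve M v m ζ) 1 := by
    rw [stepEvolve, Nat.cast_add, Nat.cast_one]
    exact (isSymmEnv_stepEnv M ζ).evolve_add v (Nat.cast_nonneg m) zero_le_one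
  rwa [h2]

theorem _root_.Real.half_le_one_sub_exp_neg {x : ℝ} (h0 : 0 ≤ x) (h1 : x ≤ 1) :
    x / 2 ≤ 1 - Real.exp (-x) := by
  have h2 := Real.add_one_le_exp x
  have h3 : Real.exp (-x) ≤ 1 - x / 2 := by
    rw [Real.exp_neg, inv_le_iff_one_le_mul₀ (Real.exp_pos x)]
    nlinarith
  linarith

namespace IsDynamicalPercolation

variable {p μ : ℝ} {η₀ : Config d n} {Ω : Type*} [MeasurableSpace Ω]
  {P : Measure Ω} {η : ℝ≥0 → Ω → Config d n}

/-- The expected squared `ℓ²` norm of the evolution in the discretised environment decreases in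
one unit of time by a multiple of the expected squared gradient. -/
theorem integral_sum_sq_stepEvolve_succ_le (h : IsDynamicalPercolation p μ η₀ P η) (hp : 0 ≤ p)
    (hp1 : p ≤ 1) (hμ : 0 ≤ μ) (hμ1 : μ ≤ 1) (hd : 1 ≤ d) {M : ℕ} (hM : 1 ≤ M)
    (v : Vertex d n → ℝ) (m : ℕ) :
    ∫ ω, ∑ y, stepEvolve M v (m + 1) (fun i => η (i / M) ω) y ^ 2 ∂P
      ≤ ∫ ω, ∑ y, stepEvolve M v m (fun i => η (i / M) ω) y ^ 2 ∂P
        - Real.exp (-1) * (p * μ / (16 * (d : ℝ) ^ 2))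
          * ∫ ω, gradSq (stepEvolve M v m fun i => η (i / M) ω) ∂P := by
  have := h.isProbabilityMeasure
  set t : ℕ → ℝ≥0 := fun i => i / M with ht
  have hM0 : (0 : ℝ) < M := by exact_mod_cast hM
  have htm : Monotone t := fun i j hij => by
    simp only [ht]
    gcongr
  have ht0 : t 0 = 0 := by simp [ht]
  have htc : ∀ i, (t i : ℝ) = i / M := fun i => by simp [ht]
  have hY : ∀ i, Measurable fun ω => η (t i) ω := fun i => h.measurable (t i)
  set Φ : ℝ → (ℕ → Config d n) → ℝ := fun s ζ =>
    energy (stepEnv M ζ (m + s)) (stepEvolve M v m ζ) with hΦ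
  have hceil : ∀ s ∈ Set.Icc (0 : ℝ) 1, ⌈(m + s) * M⌉₊ ≤ (m + 1) * M := fun s hs => by
    rw [Nat.ceil_le]
    push_cast
    exact mul_le_mul_of_nonneg_right (by linarith [hs.2]) hM0.le
  have hdep : ∀ j, DependsOn (fun ζ => ∑ y, stepEvolve M v j ζ y ^ 2) (Set.Iic (j * M)) :=
    fun j a b hab => by simp only [dependsOn_stepEvolve M v j hab]
  have hΦdep : ∀ s ∈ Set.Icc (0 : ℝ) 1, DependsOn (Φ s) (Set.Iic ((m + 1) * M)) := by
    intro s hs a b hab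
    have h1 : stepEvolve M v m a = stepEvolve M v m b := dependsOn_stepEvolve M v m fun i hi =>
      hab i (le_trans (Set.mem_Iic.1 hi) (Nat.mul_le_mul_right M (Nat.le_succ m)))
    simp only [hΦ, h1, stepEnv, hab _ (hceil s hs)]
  have hΦint : ∀ ζ, IntervalIntegrable (fun s => Φ s ζ) volume 0 1 := fun ζ =>
    ((isSymmEnv_stepEnv M ζ).shift m).intervalIntegrable_energy _ 0 1
  have hIdep : DependsOn (fun ζ => ∫ s in (0 : ℝ)..1, Φ s ζ) (Set.Iic ((m + 1) * M)) :=
    fun a b hab => by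
      refine intervalIntegral.integral_congr fun s hs => ?_
      rw [Set.uIcc_of_le zero_le_one] at hs
      exact hΦdep s hs hab
  have hint : ∀ {k : ℕ} {F : (ℕ → Config d n) → ℝ}, DependsOn F (Set.Iic k) →
      Integrable (fun ω => F fun i => η (t i) ω) P := fun hF =>
    integrable_of_dependsOn (Y := fun ω i => η (t i) ω) hY hF
  set G := ∫ ω, gradSq (stepEvolve M v m fun i => η (t i) ω) ∂P with hG
  have hG0 : 0 ≤ G := integral_nonneg fun ω => gradSq_nonneg _
  have hlow : ∀ s ∈ Set.Icc (0 : ℝ) 1,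
      s * (p * μ / (8 * (d : ℝ) ^ 2) * G) ≤ ∫ ω, Φ s (fun i => η (t i) ω) ∂P := by
    intro s hs
    have hkl : m * M ≤ ⌈(m + s) * M⌉₊ := by
      have h1 : ((m * M : ℕ) : ℝ) ≤ (m + s) * M := by
        push_cast
        exact mul_le_mul_of_nonneg_right (by linarith [hs.1]) hM0.le
      exact_mod_cast h1.trans (Nat.le_ceil _)
    have h1 := h.integral_gradSq_le_integral_energy hp hp1 hμ hd t htm ht0 hkl
      (dependsOn_stepEvolve M v m)
    refine le_trans ?_ h1
    rw [← mul_assoc]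
    refine mul_le_mul_of_nonneg_right ?_ hG0
    -- Rounding up places the sampled time at or after `m + s`, so at least time `s` has elapsed
    -- since time `m`.
    have h2 : s ≤ t ⌈(m + s) * M⌉₊ - t (m * M) := by
      rw [htc, htc, Nat.cast_mul, mul_div_cancel_right₀ _ hM0.ne', le_sub_iff_add_le,
        le_div_iff₀ hM0, add_comm]
      exact Nat.le_ceil _
    have h3 : μ * s / 2 ≤ 1 - Real.exp (-(μ * (t ⌈(m + s) * M⌉₊ - t (m * M)))) := by
      refine (Real.half_le_one_sub_exp_neg (mul_nonneg hμ hs.1)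
        (mul_le_one₀ hμ1 hs.1 hs.2)).trans ?_
      have := mul_le_mul_of_nonneg_left h2 hμ
      have := Real.exp_le_exp.2 (neg_le_neg this)
      linarith
    have hd0 : (0 : ℝ) < d := by exact_mod_cast hd
    calc s * (p * μ / (8 * (d : ℝ) ^ 2)) = p * (μ * s / 2) / (4 * (d : ℝ) ^ 2) := by
          field_simp
          ring
      _ ≤ _ := by gcongr
  have hmain : p * μ / (16 * (d : ℝ) ^ 2) * G
      ≤ ∫ ω, (∫ s in (0 : ℝ)..1, Φ s fun i => η (t i) ω) ∂P := by
    rw [integral_intervalIntegral_of_dependsOn (Y := fun ω i => η (t i) ω) hY hΦdep hΦint]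
    -- The lower bound is linear in `s`; integrating `s` over `[0, 1]` turns the `8` into `16`.
    calc p * μ / (16 * (d : ℝ) ^ 2) * G
        = ∫ s in (0 : ℝ)..1, s * (p * μ / (8 * (d : ℝ) ^ 2) * G) := by
          rw [intervalIntegral.integral_mul_const, integral_id]
          ring
      _ ≤ _ := intervalIntegral.integral_mono_on zero_le_one
          (Continuous.intervalIntegrable (by fun_prop) _ _)
          (intervalIntegrable_integral_of_dependsOn (Y := fun ω i => η (t i) ω) hY hΦdep hΦint) hlow
  calc ∫ ω, ∑ y, stepEvolve M v (m + 1) (fun i => η (t i) ω) y ^ 2 ∂P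
      ≤ ∫ ω, (∑ y, stepEvolve M v m (fun i => η (t i) ω) y ^ 2
        - Real.exp (-1) * ∫ s in (0 : ℝ)..1, Φ s fun i => η (t i) ω) ∂P :=
        integral_mono (hint (hdep (m + 1))) ((hint (hdep m)).sub ((hint hIdep).const_mul _))
          fun ω => sum_sq_stepEvolve_succ_le M v m _
    _ = ∫ ω, ∑ y, stepEvolve M v m (fun i => η (t i) ω) y ^ 2 ∂P
        - Real.exp (-1) * ∫ ω, (∫ s in (0 : ℝ)..1, Φ s fun i => η (t i) ω) ∂P := by
        rw [integral_sub (hint (hdep m)) ((hint hIdep).const_mul _), integral_const_mul]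
    _ ≤ _ := by
        rw [mul_assoc]
        exact sub_le_sub_left (mul_le_mul_of_nonneg_left hmain (Real.exp_pos _).le) _

end IsDynamicalPercolation
end DynPerc

end

/-! ### Scalar recursions: decay from Nash and Poincaré -/

theorem le_exp_mul_of_succ_le {v : ℕ → ℝ} {θ B : ℝ} (hθ1 : θ ≤ 1)
    (h : ∀ m, v (m + 1) ≤ (1 - θ) * v m) (hB : 0 ≤ B) (m₀ : ℕ) (hm₀ : v m₀ ≤ B) (k : ℕ) :
    v (m₀ + k) ≤ Real.exp (-(θ * k)) * B := by
  induction k with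
  | zero => simpa using hm₀
  | succ k ih =>
    have h1 : 1 - θ ≤ Real.exp (-θ) := by linarith [Real.add_one_le_exp (-θ)]
    calc v (m₀ + (k + 1)) ≤ (1 - θ) * v (m₀ + k) := h _
      _ ≤ (1 - θ) * (Real.exp (-(θ * k)) * B) :=
          mul_le_mul_of_nonneg_left ih (by linarith)
      _ ≤ Real.exp (-θ) * (Real.exp (-(θ * k)) * B) :=
          mul_le_mul_of_nonneg_right h1 (mul_nonneg (Real.exp_pos _).le hB)
      _ = _ := by
          rw [← mul_assoc, ← Real.exp_add]
          congr 2
          push_cast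
          ring

/-- Decay under Nash-type inequalities at all dyadic scales `2 ^ j ≤ n`. -/
theorem le_of_nash_scales {u : ℕ → ℝ} {d n : ℕ} {κ : ℝ} (hκ : 0 < κ) (hκ1 : κ ≤ 1)
    (hu : Antitone u) (hu0 : u 0 ≤ 1)
    (h : ∀ r : ℕ, 1 ≤ r → r ≤ n → ∀ m,
      u (m + 1) ≤ u m - κ / (r : ℝ) ^ 2 * (u m - 8 / (r : ℝ) ^ d)) (j : ℕ) :
    2 ^ j ≤ n → ∀ m : ℕ, 4 * ((d : ℝ) + 1) * 4 ^ j / κ ≤ m → u m ≤ 16 / ((2 : ℝ) ^ j) ^ d := by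
  induction j with
  | zero =>
    intro _ m _
    have := hu (Nat.zero_le m)
    norm_num
    linarith
  | succ j ih =>
    intro hj m hm
    have hj' : 2 ^ j ≤ n := (Nat.pow_le_pow_right (by norm_num) (Nat.le_succ j)).trans hj
    -- `4 * A` is the waiting time for scale `2 ^ j` and `16 * A` the one for `2 ^ (j + 1)`. Since
    -- `1 ≤ A`, at least `4 * A` steps remain after rounding.
    set A : ℝ := ((d : ℝ) + 1) * 4 ^ j / κ with hA
    have hA1 : 1 ≤ A := by
      rw [hA, le_div_iff₀ hκ]
      have h4 : (1 : ℝ) ≤ 4 ^ j := one_le_pow₀ (by norm_num)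
      have hd : (0 : ℝ) ≤ d := Nat.cast_nonneg d
      nlinarith
    set m₀ := ⌈4 * A⌉₊ with hm₀
    have hm₀1 : 4 * A ≤ m₀ := Nat.le_ceil _
    have hm₀2 : (m₀ : ℝ) < 4 * A + 1 := Nat.ceil_lt_add_one (by linarith)
    have hm' : 16 * A ≤ m := by
      refine le_trans (le_of_eq ?_) hm
      rw [hA]
      ring
    have hle : m₀ ≤ m := by
      have : (m₀ : ℝ) ≤ m := by linarith
      exact_mod_cast this
    obtain ⟨k, rfl⟩ := Nat.exists_eq_add_of_le hle
    have hk : 4 * A ≤ k := by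
      push_cast at hm'
      linarith
    set r : ℕ := 2 ^ (j + 1) with hr
    have hr1 : 1 ≤ r := Nat.one_le_two_pow
    have hrr : (r : ℝ) = 2 * 2 ^ j := by rw [hr]; push_cast; ring
    have hr0 : (0 : ℝ) < r := by exact_mod_cast hr1
    have hr2 : (r : ℝ) ^ 2 = 4 * 4 ^ j := by
      rw [hrr, mul_pow, ← pow_mul, mul_comm j 2, pow_mul]
      norm_num
    have hθ1 : κ / (r : ℝ) ^ 2 ≤ 1 := by
      rw [div_le_one (by positivity)]
      exact hκ1.trans (one_le_pow₀ (by exact_mod_cast hr1))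
    have hB : u m₀ - 8 / (r : ℝ) ^ d ≤ 16 * 2 ^ d / (r : ℝ) ^ d := by
      have h1 := ih hj' m₀ (by rw [hA] at hm₀1; refine le_trans (le_of_eq ?_) hm₀1; ring)
      have h2 : 16 / ((2 : ℝ) ^ j) ^ d = 16 * 2 ^ d / (r : ℝ) ^ d := by
        rw [hrr, mul_pow, mul_comm (16 : ℝ), mul_div_mul_left _ _ (by positivity)]
      have h3 : 0 ≤ 8 / (r : ℝ) ^ d := by positivity
      linarith
    have h1 := le_exp_mul_of_succ_le (v := fun m => u m - 8 / (r : ℝ) ^ d) hθ1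
      (fun m => by have := h r hr1 hj m; linarith) (by positivity) m₀ hB k
    -- During these steps the excess over `8 / r ^ d` shrinks by `e^{-(d + 1)} ≤ 2^{-(d + 1)}`,
    -- exactly what turns `16 * 2 ^ d / r ^ d` into `8 / r ^ d`.
    have h2 : Real.exp (-(κ / (r : ℝ) ^ 2 * k)) ≤ 1 / (2 * 2 ^ d) := by
      have h3 : (d : ℝ) + 1 ≤ κ / (r : ℝ) ^ 2 * k := by
        rw [hr2]
        have h4 : (0 : ℝ) < 4 * 4 ^ j := by positivity
        rw [div_mul_eq_mul_div, le_div_iff₀ h4]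
        have h5 := mul_le_mul_of_nonneg_left hk hκ.le
        refine le_trans (le_of_eq ?_) h5
        rw [hA]
        field_simp
      have h4 : (2 : ℝ) * 2 ^ d ≤ Real.exp ((d : ℝ) + 1) := by
        have h5 : (2 : ℝ) ≤ Real.exp 1 := by linarith [Real.add_one_le_exp (1 : ℝ)]
        calc (2 : ℝ) * 2 ^ d = 2 ^ (d + 1) := by ring
          _ ≤ Real.exp 1 ^ (d + 1) := pow_le_pow_left₀ (by norm_num) h5 _
          _ = Real.exp ((d : ℝ) + 1) := by rw [← Real.exp_nat_mul]; push_cast; ring_nf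
      rw [Real.exp_neg, ← one_div]
      exact one_div_le_one_div_of_le (by positivity) (h4.trans (Real.exp_le_exp.2 h3))
    have h3 : Real.exp (-(κ / (r : ℝ) ^ 2 * k)) * (16 * 2 ^ d / (r : ℝ) ^ d) ≤ 8 / (r : ℝ) ^ d := by
      refine (mul_le_mul_of_nonneg_right h2 (by positivity)).trans (le_of_eq ?_)
      field_simp
      norm_num
    have h4 : (2 : ℝ) ^ (j + 1) = r := by rw [hr]; push_cast; rfl
    rw [h4]
    have h5 : (16 : ℝ) / r ^ d = 8 / r ^ d + 8 / r ^ d := by ring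
    rw [h5]

    linarith

/-- The Nash scales are run up to the largest power of 2 below `n`, which costs the factor `2 ^ d`;
from `m₀` on, the Poincaré inequality contracts at rate `κ / n ^ 2`. -/
theorem le_exp_of_nash_poincare {u : ℕ → ℝ} {d n : ℕ} {κ : ℝ} (hn : 1 ≤ n) (hκ : 0 < κ)
    (hκ1 : κ ≤ 1) (hu : Antitone u) (hu0 : u 0 ≤ 1)
    (h : ∀ r : ℕ, 1 ≤ r → r ≤ n → ∀ m,
      u (m + 1) ≤ u m - κ / (r : ℝ) ^ 2 * (u m - 8 / (r : ℝ) ^ d))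
    (hP : ∀ m, u (m + 1) ≤ u m - κ / (n : ℝ) ^ 2 * u m) (m₀ k : ℕ)
    (hm₀ : 4 * ((d : ℝ) + 1) * (n : ℝ) ^ 2 / κ ≤ m₀) :
    (n : ℝ) ^ d * u (m₀ + k) ≤ Real.exp (-(κ / (n : ℝ) ^ 2 * k)) * (16 * 2 ^ d) := by
  have hn0 : (0 : ℝ) < n := by exact_mod_cast hn
  set j := Nat.log 2 n with hj
  have hj1 : 2 ^ j ≤ n := Nat.pow_log_le_self 2 (by omega)
  have hj2 : n < 2 ^ (j + 1) := Nat.lt_pow_succ_log_self (by norm_num) n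
  have hj1' : (2 : ℝ) ^ j ≤ n := by exact_mod_cast hj1
  have hj2' : (n : ℝ) ≤ 2 * 2 ^ j := by
    have : (n : ℝ) < 2 ^ (j + 1) := by exact_mod_cast hj2
    rw [pow_succ] at this
    linarith
  have h1 : u m₀ ≤ 16 * 2 ^ d / (n : ℝ) ^ d := by
    refine (le_of_nash_scales hκ hκ1 hu hu0 h j hj1 m₀ (le_trans ?_ hm₀)).trans ?_
    · have : (4 : ℝ) ^ j ≤ (n : ℝ) ^ 2 := by
        calc (4 : ℝ) ^ j = (2 ^ j) ^ 2 := by rw [← pow_mul, mul_comm, pow_mul]; norm_num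
          _ ≤ _ := pow_le_pow_left₀ (by positivity) hj1' 2
      gcongr
    · rw [div_le_div_iff₀ (by positivity) (by positivity), mul_assoc, ← mul_pow]
      gcongr
  have hθ1 : κ / (n : ℝ) ^ 2 ≤ 1 := by
    rw [div_le_one (by positivity)]
    exact hκ1.trans (one_le_pow₀ (by exact_mod_cast hn))
  have h2 := le_exp_mul_of_succ_le (v := u) hθ1 (fun m => by have := hP m; linarith)
    (by positivity) m₀ h1 k
  refine (mul_le_mul_of_nonneg_left h2 (by positivity)).trans (le_of_eq ?_)
  field_simp

/-! ### From the discretised environment to the quenched law -/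

noncomputable section

namespace DynPerc

/-- The grid points obtained by rounding up approach `s` from the right, where the path is
continuous. -/
theorem IsCadlag.tendsto_ceil_div {d n : ℕ} {η : ℝ≥0 → Config d n} (hη : IsCadlag η) (s : ℝ) :
    Filter.Tendsto (fun N : ℕ => η ((⌈s * (N + 1 : ℕ)⌉₊ : ℝ≥0) / (N + 1 : ℕ))) Filter.atTop
      (𝓝 (η s.toNNReal)) := by
  refine (hη s.toNNReal).1.tendsto.comp (tendsto_nhdsWithin_iff.2 ⟨?_,
    Filter.Eventually.of_forall fun N => ?_⟩)
  · rw [← NNReal.tendsto_coe]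
    have h := (tendsto_nat_ceil_mul_div_atTop (R := ℝ) (NNReal.coe_nonneg s.toNNReal)).comp
      (tendsto_natCast_atTop_atTop.comp (Filter.tendsto_add_atTop_nat 1))
    refine h.congr fun N => ?_
    simp only [Function.comp_apply, NNReal.coe_div, NNReal.coe_natCast]
    congr 2
    rcases le_total 0 s with hs | hs
    · rw [Real.coe_toNNReal s hs]
    · rw [Real.toNNReal_of_nonpos hs, Nat.ceil_eq_zero.2, Nat.ceil_eq_zero.2]
      · exact mul_nonpos_of_nonpos_of_nonneg hs (Nat.cast_nonneg _)
      · simp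
  · rw [Set.mem_Ici, ← NNReal.coe_le_coe, NNReal.coe_div, NNReal.coe_natCast, NNReal.coe_natCast,
      Real.coe_toNNReal']
    have hN : (0 : ℝ) < (N + 1 : ℕ) := by positivity
    exact max_le ((le_div_iff₀ hN).2 (Nat.le_ceil _)) (by positivity)

variable {d n : ℕ} [NeZero n]

theorem card_vertex (d n : ℕ) [NeZero n] : (Fintype.card (Vertex d n) : ℝ) = (n : ℝ) ^ d := by
  simp [ZMod.card]

/-- The point mass at `x` minus the uniform distribution. -/
def centredDirac (x : Vertex d n) (y : Vertex d n) : ℝ :=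
  (Pi.single x 1 : Vertex d n → ℝ) y - 1 / (n : ℝ) ^ d

theorem sum_centredDirac (x : Vertex d n) : ∑ y, centredDirac x y = 0 := by
  have hn : (n : ℝ) ^ d ≠ 0 := pow_ne_zero _ (NeZero.ne _)
  simp only [centredDirac, Finset.sum_sub_distrib, Finset.sum_const, Finset.card_univ,
    nsmul_eq_mul, card_vertex]
  rw [mul_one_div_cancel hn]
  simp

theorem sum_sq_centredDirac_le (x : Vertex d n) : ∑ y, centredDirac x y ^ 2 ≤ 1 := by
  have hn : (0 : ℝ) < (n : ℝ) ^ d := pow_pos (Nat.cast_pos.2 (NeZero.pos n)) _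
  have h : ∀ y, centredDirac x y ^ 2
      = (1 - 1 / (n : ℝ) ^ d) * (Pi.single x 1 : Vertex d n → ℝ) y
        - 1 / (n : ℝ) ^ d * centredDirac x y := by
    intro y
    by_cases hy : y = x
    · subst hy
      simp only [centredDirac, Pi.single_eq_same]
      ring
    · simp only [centredDirac, Pi.single_eq_of_ne hy]
      ring
  simp only [h, Finset.sum_sub_distrib, ← Finset.mul_sum, sum_centredDirac]
  have : 0 < 1 / (n : ℝ) ^ d := by positivity
  simp only [Finset.sum_pi_single', Finset.mem_univ, if_true]
  linarith

theorem sum_abs_centredDirac_le (x : Vertex d n) : ∑ y, |centredDirac x y| ≤ 2 := by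
  have hn : (0 : ℝ) < (n : ℝ) ^ d := pow_pos (Nat.cast_pos.2 (NeZero.pos n)) _
  have h : ∀ y, |centredDirac x y|
      ≤ (Pi.single x 1 : Vertex d n → ℝ) y + 1 / (n : ℝ) ^ d := by
    intro y
    have h1 : 0 ≤ (Pi.single x 1 : Vertex d n → ℝ) y := by
      by_cases hy : y = x
      · subst hy; simp
      · simp [Pi.single_eq_of_ne hy]
    have h2 : 0 < 1 / (n : ℝ) ^ d := by positivity
    exact abs_le.2 ⟨by rw [centredDirac]; linarith, by rw [centredDirac]; linarith⟩
  refine (Finset.sum_le_sum fun y _ => h y).trans ?_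
  simp only [Finset.sum_add_distrib, Finset.sum_const, Finset.card_univ,
    nsmul_eq_mul, card_vertex]
  rw [mul_one_div_cancel hn.ne']
  simp only [Finset.sum_pi_single', Finset.mem_univ, if_true]
  norm_num

theorem attemptsIntegral_eq_iter (η : ℝ≥0 → Config d n) (x : Vertex d n) (k : ℕ) :
    ∀ t y, attemptsIntegral η x k t y
      = iter (fun s => attempt (η s.toNNReal)) (Pi.single x 1) k t y := by
  induction k with
  | zero => intro t y; simp [attemptsIntegral, iter, Pi.single_apply, eq_comm]
  | succ k ih =>
    intro t y
    simp only [attemptsIntegral, iter, act, ih]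

theorem quenchedLaw_eq_evolve (η : ℝ≥0 → Config d n) (x : Vertex d n) (t : ℝ≥0) (y : Vertex d n) :
    quenchedLaw η x t y = evolve (fun s => attempt (η s.toNNReal)) (Pi.single x 1) t y := by
  simp only [quenchedLaw, evolve, attemptsIntegral_eq_iter]

theorem IsCadlag.tendsto_stepEnv {η : ℝ≥0 → Config d n} (hη : IsCadlag η) (s : ℝ)
    (x y : Vertex d n) :
    Filter.Tendsto (fun N : ℕ => stepEnv (N + 1) (fun i => η (i / (N + 1 : ℕ))) s x y)
      Filter.atTop (𝓝 (attempt (η s.toNNReal) x y)) :=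
  ((continuous_of_discreteTopology (f := fun ζ : Config d n => attempt ζ x y)).tendsto _).comp
    (hη.tendsto_ceil_div s)

theorem IsCadlag.isSymmEnv {η : ℝ≥0 → Config d n} (hη : IsCadlag η) :
    IsSymmEnv fun s => attempt (η s.toNNReal) where
  stoch _ := isSymmStochastic_attempt _
  meas x y := measurable_of_tendsto_metrizable
    (fun N : ℕ => (isSymmEnv_stepEnv (N + 1) fun i => η (i / (N + 1 : ℕ))).meas x y)
    (tendsto_pi_nhds.2 fun s => hη.tendsto_stepEnv s x y)

theorem tvUniform_quenchedLaw {η : ℝ≥0 → Config d n} (hη : IsCadlag η) (x : Vertex d n)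
    (t : ℝ≥0) :
    tvUniform (quenchedLaw η x t)
      = (1 / 2) * ∑ y, |evolve (fun s => attempt (η s.toNNReal)) (centredDirac x) t y| := by
  rw [tvUniform]
  congr 1
  refine Finset.sum_congr rfl fun y _ => ?_
  rw [quenchedLaw_eq_evolve]
  congr 1
  exact (hη.isSymmEnv.evolve_sub_const _ _ t.2 y).symm

theorem sq_half_sum_abs_le (g : Vertex d n → ℝ) :
    ((1 / 2) * ∑ y, |g y|) ^ 2 ≤ (n : ℝ) ^ d * (∑ y, g y ^ 2) / 4 := by
  have h := sq_sum_le_card_mul_sum_sq (s := Finset.univ) (f := fun y => |g y|)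
  simp only [Finset.card_univ, card_vertex, sq_abs] at h
  rw [mul_pow]
  linarith

namespace IsDynamicalPercolation

variable {p μ : ℝ} {η₀ : Config d n} {Ω : Type*} [MeasurableSpace Ω]
  {P : Measure Ω} {η : ℝ≥0 → Ω → Config d n}

/-- Decay of the expected squared `ℓ²` distance to uniform in the discretised environment. -/
theorem integral_sum_sq_stepEvolve_le (h : IsDynamicalPercolation p μ η₀ P η)
    (hp1 : p ≤ 1) (hμ1 : μ ≤ 1) (hd : 1 ≤ d) {M : ℕ} (hM : 1 ≤ M)
    (x : Vertex d n) {κ : ℝ} (hμ : 0 < μ) (hκ : 0 < κ)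
    (hκp : κ ≤ Real.exp (-1) * p * μ / (32 * (d : ℝ) ^ 3)) (m₀ k : ℕ)
    (hm₀ : 4 * ((d : ℝ) + 1) * (n : ℝ) ^ 2 / κ ≤ m₀) :
    (n : ℝ) ^ d * ∫ ω, ∑ y, stepEvolve M (centredDirac x) (m₀ + k) (fun i => η (i / M) ω) y ^ 2 ∂P
      ≤ Real.exp (-(κ / (n : ℝ) ^ 2 * k)) * (16 * 2 ^ d) := by
  have := h.isProbabilityMeasure
  have hd1 : (1 : ℝ) ≤ d := by exact_mod_cast hd
  have hd0 : (0 : ℝ) < d := by linarith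
  have hn1 : 1 ≤ n := NeZero.one_le
  have hn0 : (0 : ℝ) < n := by exact_mod_cast hn1
  have he : Real.exp (-1) ≤ 1 := Real.exp_le_one_iff.2 (by norm_num)
  have hp : 0 < p := by
    have h1 : 0 < Real.exp (-1) * p * μ / (32 * (d : ℝ) ^ 3) := hκ.trans_le hκp
    by_contra hp
    have h2 : Real.exp (-1) * p * μ ≤ 0 := mul_nonpos_of_nonpos_of_nonneg
      (mul_nonpos_of_nonneg_of_nonpos (Real.exp_pos _).le (not_lt.1 hp)) hμ.le
    exact absurd h1 (not_lt.2 (div_nonpos_of_nonpos_of_nonneg h2 (by positivity)))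
  have hκ1 : κ ≤ 1 := by
    refine hκp.trans ((div_le_one (by positivity)).2 ?_)
    have h1 : Real.exp (-1) * p * μ ≤ 1 :=
      mul_le_one₀ (mul_le_one₀ he hp.le hp1) hμ.le hμ1
    have h2 : (1 : ℝ) ≤ (d : ℝ) ^ 3 := one_le_pow₀ hd1
    linarith
  set g : ℕ → Ω → Vertex d n → ℝ := fun m ω =>
    stepEvolve M (centredDirac x) m fun i => η (i / M) ω with hg
  set u : ℕ → ℝ := fun m => ∫ ω, ∑ y, g m ω y ^ 2 ∂P with hu
  set e : ℕ → ℝ := fun m => ∫ ω, gradSq (g m ω) ∂P with he'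
  set a := Real.exp (-1) * (p * μ / (16 * (d : ℝ) ^ 2)) with ha
  -- The factor `2 * d` is the one in front of the gradient in `sum_sq_le_gradSq_add`; it fixes the
  -- `32 * d ^ 3` in the bound on `κ`.
  have haκ : κ * (2 * d) ≤ a := by
    refine (mul_le_mul_of_nonneg_right hκp (by positivity)).trans (le_of_eq ?_)
    rw [ha]
    field_simp
    norm_num
  have hY : ∀ i : ℕ, Measurable fun ω => η (i / M) ω := fun i => h.measurable _
  have hdep := fun m => dependsOn_stepEvolve M (centredDirac x) m
  have hint1 : ∀ m, Integrable (fun ω => ∑ y, g m ω y ^ 2) P := fun m =>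
    integrable_of_dependsOn (Y := fun ω (i : ℕ) => η (i / M) ω) (k := m * M)
      (F := fun ζ => ∑ y, stepEvolve M (centredDirac x) m ζ y ^ 2) hY
      fun a b hab => by simp only [hdep m hab]
  have hint2 : ∀ m, Integrable (fun ω => gradSq (g m ω)) P := fun m =>
    integrable_of_dependsOn (Y := fun ω (i : ℕ) => η (i / M) ω) (k := m * M)
      (F := fun ζ => gradSq (stepEvolve M (centredDirac x) m ζ)) hY
      fun a b hab => by simp only [hdep m hab]
  have he0 : ∀ m, 0 ≤ e m := fun m => integral_nonneg fun ω => gradSq_nonneg _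
  have hstep : ∀ m, u (m + 1) ≤ u m - a * e m := fun m =>
    h.integral_sum_sq_stepEvolve_succ_le hp.le hp1 hμ.le hμ1 hd hM (centredDirac x) m
  have ha0 : 0 < a := by positivity
  have hanti : Antitone u := antitone_nat_of_succ_le fun m =>
    (hstep m).trans (sub_le_self _ (mul_nonneg ha0.le (he0 m)))
  have hu0 : u 0 ≤ 1 := by
    have h1 : ∀ ω, g 0 ω = centredDirac x := fun ω => by
      simp only [hg, stepEvolve, Nat.cast_zero]
      exact IsSymmEnv.evolve_zero _
    simp only [hu, h1]
    simpa using sum_sq_centredDirac_le x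
  -- The `8` is `2 * 2 ^ 2`, with 2 the deterministic bound on the `ℓ¹` norm.
  have hnash : ∀ r : ℕ, 1 ≤ r → r ≤ n → ∀ m,
      u m ≤ 2 * (d * (r : ℝ) ^ 2 * e m) + 8 / (r : ℝ) ^ d := by
    intro r hr hrn m
    have hr0 : (0 : ℝ) < r := by exact_mod_cast hr
    have h1 : ∀ ω, ∑ y, g m ω y ^ 2
        ≤ 2 * (d * (r : ℝ) ^ 2 * gradSq (g m ω)) + 8 / (r : ℝ) ^ d := by
      intro ω
      refine (sum_sq_le_gradSq_add hr hrn (g m ω)).trans ?_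
      have h2 : ∑ y, |g m ω y| ≤ 2 := ((isSymmEnv_stepEnv M _).sum_abs_evolve_le _
        (Nat.cast_nonneg m)).trans (sum_abs_centredDirac_le x)
      have h3 : (∑ y, |g m ω y|) ^ 2 ≤ 2 ^ 2 :=
        pow_le_pow_left₀ (Finset.sum_nonneg fun y _ => abs_nonneg _) h2 2
      have h4 : (∑ y, |g m ω y|) ^ 2 / (r : ℝ) ^ d ≤ 2 ^ 2 / (r : ℝ) ^ d := by gcongr
      have h5 : (8 : ℝ) / r ^ d = 2 * (2 ^ 2 / r ^ d) := by ring
      linarith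
    refine (integral_mono (g := fun ω => 2 * (d * (r : ℝ) ^ 2 * gradSq (g m ω)) + 8 / (r : ℝ) ^ d)
      (hint1 m) ((((hint2 m).const_mul _).const_mul _).add (integrable_const _)) h1).trans (le_of_eq ?_)
    rw [integral_add (((hint2 m).const_mul _).const_mul _) (integrable_const _),
      integral_const_mul, integral_const_mul]
    simp [he']
  have hpoin : ∀ m, u m ≤ d * (n : ℝ) ^ 2 * e m := by
    intro m
    have h1 : ∀ ω, ∑ y, g m ω y ^ 2 ≤ d * (n : ℝ) ^ 2 * gradSq (g m ω) := fun ω =>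
      sum_sq_le_gradSq _ (((isSymmEnv_stepEnv M _).sum_evolve _
        (Nat.cast_nonneg m)).trans (sum_centredDirac x))
    refine (integral_mono (hint1 m) ((hint2 m).const_mul _) h1).trans (le_of_eq ?_)
    rw [integral_const_mul]
  refine le_exp_of_nash_poincare hn1 hκ hκ1 hanti hu0 (fun r hr hrn m => ?_) (fun m => ?_) m₀ k hm₀
  · have hr0 : (0 : ℝ) < r := by exact_mod_cast hr
    have h1 : κ / (r : ℝ) ^ 2 * (u m - 8 / (r : ℝ) ^ d) ≤ a * e m := by
      calc κ / (r : ℝ) ^ 2 * (u m - 8 / (r : ℝ) ^ d)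
          ≤ κ / (r : ℝ) ^ 2 * (2 * (d * (r : ℝ) ^ 2 * e m)) :=
            mul_le_mul_of_nonneg_left (by linarith [hnash r hr hrn m]) (by positivity)
        _ = κ * (2 * d) * e m := by field_simp
        _ ≤ a * e m := mul_le_mul_of_nonneg_right haκ (he0 m)
    linarith [hstep m]
  · have h1 : κ / (n : ℝ) ^ 2 * u m ≤ a * e m := by
      calc κ / (n : ℝ) ^ 2 * u m ≤ κ / (n : ℝ) ^ 2 * (d * (n : ℝ) ^ 2 * e m) :=
            mul_le_mul_of_nonneg_left (hpoin m) (by positivity)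
        _ = κ * d * e m := by field_simp
        _ ≤ κ * (2 * d) * e m := mul_le_mul_of_nonneg_right
            (mul_le_mul_of_nonneg_left (by linarith) hκ.le) (he0 m)
        _ ≤ a * e m := mul_le_mul_of_nonneg_right haκ (he0 m)
    linarith [hstep m]

/-- A bound for the expected squared distance to uniform, uniform in the discretisation, bounds
the probability that the quenched law is far from uniform. -/
theorem measure_tvUniform_gt_le (h : IsDynamicalPercolation p μ η₀ P η) (x : Vertex d n) {ε : ℝ}
    (hε : 0 < ε) (m : ℕ)
    (hm : ∀ M : ℕ, 1 ≤ M → (n : ℝ) ^ d *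
      ∫ ω, ∑ y, stepEvolve M (centredDirac x) m (fun i => η (i / M) ω) y ^ 2 ∂P ≤ 4 * ε ^ 3) :
    P {ω | ε < tvUniform (quenchedLaw (fun t => η t ω) x m)} ≤ ENNReal.ofReal ε := by
  have := h.isProbabilityMeasure
  set g : ℕ → Ω → Vertex d n → ℝ := fun N ω =>
    stepEvolve (N + 1) (centredDirac x) m fun i => η (i / (N + 1 : ℕ)) ω with hg
  set A : ℕ → Set Ω := fun N => {ω | ε < (1 / 2) * ∑ y, |g N ω y|} with hA
  have hPA : ∀ N, P (A N) ≤ ENNReal.ofReal ε := by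
    intro N
    have hint : Integrable (fun ω => (n : ℝ) ^ d * ∑ y, g N ω y ^ 2) P :=
      (integrable_of_dependsOn (Y := fun ω (i : ℕ) => η (i / (N + 1 : ℕ)) ω) (k := m * (N + 1))
        (F := fun ζ => ∑ y, stepEvolve (N + 1) (centredDirac x) m ζ y ^ 2)
        (fun i => h.measurable _)
        fun a b hab => by simp only [dependsOn_stepEvolve (N + 1) (centredDirac x) m hab]).const_mul _
    have h1 := mul_meas_ge_le_integral_of_nonneg (Filter.Eventually.of_forall fun ω =>
      (by positivity : (0 : ℝ) ≤ (n : ℝ) ^ d * ∑ y, g N ω y ^ 2)) hint (4 * ε ^ 2)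
    rw [integral_const_mul] at h1
    have h2 := h1.trans (hm (N + 1) (by omega))
    -- Markov's inequality at level `4 * ε ^ 2`, which is where a total variation distance above `ε`
    -- forces the rescaled squared norm to lie.
    have h3 : P.real {ω | 4 * ε ^ 2 ≤ (n : ℝ) ^ d * ∑ y, g N ω y ^ 2} ≤ ε := by
      have h4 : 4 * ε ^ 3 = 4 * ε ^ 2 * ε := by ring
      rw [h4] at h2
      exact le_of_mul_le_mul_left h2 (by positivity)
    have h4 : A N ⊆ {ω | 4 * ε ^ 2 ≤ (n : ℝ) ^ d * ∑ y, g N ω y ^ 2} := by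
      intro ω hω
      have h5 := sq_half_sum_abs_le (g N ω)
      have h6 := pow_le_pow_left₀ hε.le (le_of_lt hω) 2
      show 4 * ε ^ 2 ≤ _
      linarith
    rw [ENNReal.le_ofReal_iff_toReal_le (measure_ne_top _ _) hε.le]
    exact (measureReal_mono h4).trans h3
  -- The strict inequality is inherited by all sufficiently fine discretisations, so the event lies
  -- in the increasing union of the tail intersections, each of probability at most `ε`.
  have hsub : {ω | ε < tvUniform (quenchedLaw (fun t => η t ω) x m)} ⊆ ⋃ N, ⋂ j ≥ N, A j := by
    intro ω hω
    have hc := h.cadlag ω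
    have htend : Filter.Tendsto (fun N => (1 / 2) * ∑ y, |g N ω y|) Filter.atTop
        (𝓝 (tvUniform (quenchedLaw (fun t => η t ω) x m))) := by
      rw [tvUniform_quenchedLaw hc]
      refine (tendsto_finsetSum _ fun y _ => Filter.Tendsto.abs ?_).const_mul _
      exact IsSymmEnv.tendsto_evolve (fun N => isSymmEnv_stepEnv _ _) _
        (fun s x y => hc.tendsto_stepEnv s x y) (Nat.cast_nonneg m) y
    obtain ⟨N, hN⟩ := Filter.eventually_atTop.1 (htend.eventually (lt_mem_nhds hω))
    exact Set.mem_iUnion.2 ⟨N, Set.mem_iInter₂.2 hN⟩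
  have hmono : Monotone fun N => ⋂ j ≥ N, A j := fun N N' hN =>
    Set.biInter_subset_biInter_left fun j hj => le_trans hN hj
  refine (measure_mono hsub).trans ?_
  rw [hmono.measure_iUnion]
  exact iSup_le fun N => (measure_mono (Set.biInter_subset_of_mem le_rfl)).trans (hPA N)

end IsDynamicalPercolation

theorem tvUniform_gt_of_le_quenchedMixingTime {ε : ℝ} {x : Vertex d n} {η : ℝ≥0 → Config d n}
    {t : ℝ≥0} {T : ℝ≥0∞} (hT : T ≤ quenchedMixingTime ε x η) (ht : t < T) :
    ε < tvUniform (quenchedLaw η x t) := by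
  by_contra hcon
  have h : quenchedMixingTime ε x η ≤ t :=
    iInf₂_le (f := fun (s : ℝ≥0) (_ : tvUniform (quenchedLaw η x s) ≤ ε) => (s : ℝ≥0∞)) t
      (not_lt.1 hcon)
  exact absurd (hT.trans h) (not_le.2 ht)

/-! ### Choice of constants and conclusion -/

theorem measure_quenchedMixingTime_ge_le {p μ δ ε : ℝ} (hd : 1 ≤ d) (hδ : 0 < δ) (hδp : δ ≤ p)
    (hp1 : p ≤ 1) (hμ : 0 < μ) (hμ1 : μ ≤ 1) (hε : 0 < ε) {η₀ : Config d n} {Ω : Type*}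
    [MeasurableSpace Ω] {P : Measure Ω} {η : ℝ≥0 → Ω → Config d n}
    (h : IsDynamicalPercolation p μ η₀ P η) (x : Vertex d n) :
    P {ω | ENNReal.ofReal ((9 * d + 20) * (32 * (d : ℝ) ^ 3) * Real.exp 1 / δ * (n : ℝ) ^ 2 *
        max (Real.log (1 / ε)) (Real.log 2) / μ) ≤ quenchedMixingTime ε x fun t => η t ω}
      ≤ ENNReal.ofReal ε := by
  have hd0 : (0 : ℝ) < d := by exact_mod_cast hd
  have hn1 : (1 : ℝ) ≤ n := by exact_mod_cast (NeZero.one_le : 1 ≤ n)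
  have hn0 : (0 : ℝ) < n := by linarith
  set κ : ℝ := Real.exp (-1) * δ * μ / (32 * (d : ℝ) ^ 3) with hκ
  set Λ := max (Real.log (1 / ε)) (Real.log 2) with hΛ
  have hκ0 : 0 < κ := by positivity
  have hκp : κ ≤ Real.exp (-1) * p * μ / (32 * (d : ℝ) ^ 3) := by
    rw [hκ]
    gcongr
  have hκ1 : κ ≤ 1 := by
    rw [hκ, div_le_one (by positivity)]
    have h1 : Real.exp (-1) * δ * μ ≤ 1 := mul_le_one₀ (mul_le_one₀
      (Real.exp_le_one_iff.2 (by norm_num)) hδ.le (hδp.trans hp1)) hμ.le hμ1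
    have h2 : (1 : ℝ) ≤ (d : ℝ) ^ 3 := one_le_pow₀ (by exact_mod_cast hd)
    linarith
  have hΛ1 : 1 / 2 ≤ Λ := by
    have := Real.log_two_gt_d9
    exact le_trans (by linarith) (le_max_right _ _)
  have hthr : (9 * d + 20) * (32 * (d : ℝ) ^ 3) * Real.exp 1 / δ * (n : ℝ) ^ 2 * Λ / μ
      = (9 * d + 20) * ((n : ℝ) ^ 2 / κ * Λ) := by
    rw [hκ, Real.exp_neg]
    field_simp
  rw [hthr]
  set R := (n : ℝ) ^ 2 / κ with hR
  have hR1 : 1 ≤ R := by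
    rw [hR, le_div_iff₀ hκ0, one_mul]
    exact hκ1.trans (one_le_pow₀ hn1)
  -- `m₀` is the burn-in that reaches `E‖v‖²` of order `n^{-d}`; `k` is the Poincaré phase. In `d +
  -- 5`, 3 units produce `ε ^ 3`, and `d + 2` units turn `16 * 2 ^ d` into `4`.
  set m₀ := ⌈4 * ((d : ℝ) + 1) * R⌉₊ with hm₀
  set k := ⌈R * ((d + 5) * Λ)⌉₊ with hk
  have hm₀1 : 4 * ((d : ℝ) + 1) * R ≤ m₀ := Nat.le_ceil _
  have hm₀2 : (m₀ : ℝ) < 4 * ((d : ℝ) + 1) * R + 1 := Nat.ceil_lt_add_one (by positivity)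
  have hk1 : R * ((d + 5) * Λ) ≤ k := Nat.le_ceil _
  have hk2 : (k : ℝ) < R * ((d + 5) * Λ) + 1 := Nat.ceil_lt_add_one (by positivity)
  have hexp : Real.exp (-(κ / (n : ℝ) ^ 2 * k)) * (16 * 2 ^ d) ≤ 4 * ε ^ 3 := by
    have h1 : (d + 5) * Λ ≤ κ / (n : ℝ) ^ 2 * k := by
      refine le_trans (le_of_eq ?_) (mul_le_mul_of_nonneg_left hk1 (by positivity))
      rw [hR]
      field_simp
    have h2 : 3 * Real.log (1 / ε) + (d + 2) * Real.log 2 ≤ (d + 5) * Λ := by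
      have h3 : Real.log (1 / ε) ≤ Λ := le_max_left _ _
      have h4 : Real.log 2 ≤ Λ := le_max_right _ _
      have h5 := mul_le_mul_of_nonneg_left h4 (by positivity : (0 : ℝ) ≤ d + 2)
      linarith
    have h3 : Real.exp (-(3 * Real.log (1 / ε) + (d + 2) * Real.log 2)) = ε ^ 3 / 2 ^ (d + 2) := by
      rw [one_div, Real.log_inv, neg_add, Real.exp_add, Real.exp_neg ((d + 2) * Real.log 2)]
      have h4 : Real.exp (-(3 * -Real.log ε)) = ε ^ 3 := by
        have : -(3 * -Real.log ε) = (3 : ℕ) * Real.log ε := by push_cast; ring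
        rw [this, Real.exp_nat_mul, Real.exp_log hε]
      have h5 : Real.exp ((d + 2) * Real.log 2) = 2 ^ (d + 2) := by
        have : ((d : ℝ) + 2) * Real.log 2 = ((d + 2 : ℕ) : ℝ) * Real.log 2 := by push_cast; ring
        rw [this, Real.exp_nat_mul, Real.exp_log (by norm_num)]
      rw [h4, h5, div_eq_mul_inv]
    calc _ ≤ ε ^ 3 / 2 ^ (d + 2) * (16 * 2 ^ d) := by
          refine mul_le_mul_of_nonneg_right ?_ (by positivity)
          rw [← h3]
          exact Real.exp_le_exp.2 (by linarith)
      _ = 4 * ε ^ 3 := by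
          rw [pow_add]
          field_simp
          norm_num
  -- Because `1 / 2 ≤ Λ` and `1 ≤ R`, the burn-in and the two roundings are absorbed into multiples
  -- of `R * Λ`. Strictness places the time `m₀ + k` before the threshold.
  have hlt : ((m₀ + k : ℕ) : ℝ) < (9 * d + 20) * (R * Λ) := by
    push_cast
    have h1 : R ≤ 2 * (R * Λ) := by nlinarith
    have h2 := mul_le_mul_of_nonneg_left h1 (by positivity : (0 : ℝ) ≤ 4 * ((d : ℝ) + 1))
    nlinarith
  refine (measure_mono fun ω hω => ?_).trans (h.measure_tvUniform_gt_le x hε (m₀ + k) fun M hM =>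
    (h.integral_sum_sq_stepEvolve_le hp1 hμ1 hd hM x hμ hκ0 hκp m₀ k (by
      refine le_trans (le_of_eq ?_) hm₀1
      rw [hR, mul_div_assoc])).trans hexp)
  refine tvUniform_gt_of_le_quenchedMixingTime hω ?_
  rw [← ENNReal.ofReal_coe_nnreal, ENNReal.ofReal_lt_ofReal_iff_of_nonneg (NNReal.coe_nonneg _)]
  exact_mod_cast hlt

end DynPerc

end

theorem theorem1p4 (d : ℕ) (hd : 1 ≤ d) (δ : ℝ) (hδ : 0 < δ) :
    ∃ C : ℝ, 0 < C ∧
      ∀ (p μ : ℝ), δ ≤ p → p ≤ 1 → 0 < μ → μ ≤ 1 / 2 →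
      ∀ (n : ℕ) [NeZero n] (ε : ℝ), 0 < ε → ε < 1 →
      ∀ (x : DynPerc.Vertex d n) (η₀ : DynPerc.Config d n)
        {Ω : Type*} [MeasurableSpace Ω] (P : Measure Ω) (η : ℝ≥0 → Ω → DynPerc.Config d n),
        DynPerc.IsDynamicalPercolation p μ η₀ P η →
        P {ω | ENNReal.ofReal
                (C * (n : ℝ) ^ 2 * max (Real.log (1 / ε)) (Real.log 2) / μ ^ 4) ≤
              DynPerc.quenchedMixingTime ε x (fun t => η t ω)} ≤ ENNReal.ofReal ε := by
  refine ⟨(9 * d + 20) * (32 * (d : ℝ) ^ 3) * Real.exp 1 / δ, ?_, ?_⟩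
  · have hd0 : (0 : ℝ) < d := by exact_mod_cast hd
    positivity
  intro p μ hδp hp1 hμ hμ2 n _ ε hε _ x η₀ Ω _ P η h
  have hμ1 : μ ≤ 1 := by linarith
  refine (measure_mono fun ω hω => ?_).trans
    (DynPerc.measure_quenchedMixingTime_ge_le hd hδ hδp hp1 hμ hμ1 hε h x)
  refine le_trans (ENNReal.ofReal_le_ofReal ?_) hω
  have hΛ : 0 ≤ max (Real.log (1 / ε)) (Real.log 2) :=
    (Real.log_nonneg one_le_two).trans (le_max_right _ _)
  -- The bound already proved has `μ` in the denominator, and `μ ^ 4 ≤ μ` for `μ ≤ 1`.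
  refine div_le_div_of_nonneg_left (by positivity) (by positivity) ?_
  exact pow_le_of_le_one hμ.le hμ1 (by norm_num)
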